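/- Let $-\infty \le a \le b \le \infty$ and let $f : (a,b) \to \mathbb{R}$ be a locally integrable function whose $4$th distributional derivative is non-negative, that is, $\int_a^b f(x)\,\varphi^{(4)}(x)\,dx \ge 0$ for every non-negative test function $\varphi \in C_c^\infty((a,b))$. Let $A$ and $B$ be Hermitian $n \times n$ matrices, and let $J$ be the open set of all $t \in \mathbb{R}$ such that all eigenvalues of $A + tB$ lie in $(a,b)$. Then the function $$ t \mapsto \operatorname{tr} f(A + tB), \qquad t \in J, $$ where $f(A+tB)$ is defined by the functional calculus, is locally integrable on $J$ and its $4$th distributional derivative on $J$ is non-negative, that is, $\int_J \operatorname{tr} f(A+tB)\,\psi^{(4)}(t)\,dt \ge 0$ for every non-negative $\psi \in C_c^\infty(J)$. -/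

import Mathlib

open MeasureTheory
open scoped ContDiff

/-- The open interval `(a, b)` of real numbers; the end points may be infinite. -/
def realInterval (a b : EReal) : Set ℝ := {x : ℝ | a < (x : EReal) ∧ (x : EReal) < b}

/-- On the open set `U ⊆ ℝ`, the function `f` is locally integrable, hence defines a distribution,
and the `k`-th distributional derivative of `f` is non-negative, that is
`⟨f⁽ᵏ⁾, φ⟩ = (-1)ᵏ ∫_U f φ⁽ᵏ⁾ ≥ 0` for every non-negative test function `φ ∈ C_c^∞(U)`.
The values of `f` outside `U` play no role. -/
structure HasNonnegDistribDeriv (k : ℕ) (f : ℝ → ℝ) (U : Set ℝ) : Prop where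
  locallyIntegrableOn : LocallyIntegrableOn f U
  nonneg : ∀ φ : ℝ → ℝ, ContDiff ℝ ∞ φ → HasCompactSupport φ → tsupport φ ⊆ U →
    (∀ x, 0 ≤ φ x) → 0 ≤ (-1) ^ k * ∫ x in U, f x * iteratedDeriv k φ x

/-- The trace `tr f(M)` of a Hermitian matrix `M`, with `f(M)` given by the functional calculus;
`f(M)` is Hermitian, so that its trace is real. -/
noncomputable def traceFun {n : ℕ} (f : ℝ → ℝ) (M : Matrix (Fin n) (Fin n) ℂ) : ℝ :=
  (cfc f M).trace.re

/-- The set of those real `t` for which all eigenvalues of `A + t B` lie in `I`, so that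
`f(A + t B)` makes sense for a function `f` on `I`. It is open when `I` is an open interval
and `A` and `B` are Hermitian. -/
def pencilDomain {n : ℕ} (I : Set ℝ) (A B : Matrix (Fin n) (Fin n) ℂ) : Set ℝ :=
  {t : ℝ | spectrum ℝ (A + t • B) ⊆ I}

/-!
For a polynomial `p`, the fourth derivative of `t ↦ tr p(A + t B)` is, in an eigenbasis of
`A + t B`, a positive multiple of the sum of `B i j * B j k * B k l * B l i` times the divided
difference of `p'` at the eigenvalues `xᵢ, xⱼ, xₖ, xₗ`. This divided difference is the integral of
`p⁽⁴⁾(s)` against half the divided difference of `u ↦ (u - s)₊ ^ 2`. The kernel splits into terms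
that belong to the pairs of opposite nodes of the cycle `i, j, k, l`, and over all cycles each of
these terms sums to a combination of squares with non-negative weights. Hence the fourth
derivative is non-negative if `p⁽⁴⁾` is.

For a general `f`, mollification and the Weierstrass theorem give uniformly bounded polynomials with
non-negative fourth derivative that converge to `f` almost everywhere on a compact interval. An
exceptional null set of `x` may be hit by an eigenvalue for many `t`, but for almost every `t` only
by an eigenvalue which the whole pencil has in common. So changing `f` on a null set changes the
trace by a constant almost everywhere, and one can pass to the limit.
-/

open Polynomial Filter Topology

/-! ### Divided differences of polynomials -/

section DivDiff

variable {R : Type*} [CommRing R]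

/-- The divided difference of the power `x ↦ x ^ N` at the nodes in a list, which is the complete
homogeneous symmetric polynomial of degree `N + 1 - l.length` in these nodes. The recursion is
Leibniz' rule for `x ^ (N + 1) = x * x ^ N`, so that no division occurs and nodes may coincide. -/
def powDivDiff : ℕ → List R → R
  | _, [] => 0
  | N, [x] => x ^ N
  | 0, _ :: _ :: _ => 0
  | N + 1, x :: y :: l => x * powDivDiff N (x :: y :: l) + powDivDiff N (y :: l)

theorem sub_mul_powDivDiff (N : ℕ) (x y : R) (l : List R) :
    (x - y) * powDivDiff N (x :: y :: l) = powDivDiff N (x :: l) - powDivDiff N (y :: l) := by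
  induction N with
  | zero => cases l <;> simp [powDivDiff]
  | succ N ih =>
    cases l <;> simp only [powDivDiff] at ih ⊢ <;> linear_combination x * ih

theorem powDivDiff_perm (N : ℕ) {l l' : List R} (h : l.Perm l') :
    powDivDiff N l = powDivDiff N l' := by
  induction N generalizing l l' with
  | zero =>
    match l, l', h.length_eq with
    | [], [], _ => rfl
    | [x], [y], _ => simp [powDivDiff]
    | _ :: _ :: _, _ :: _ :: _, _ => simp [powDivDiff]
  | succ N ih =>
    induction h with
    | nil => rfl
    | @cons x l l' h _ =>
      match l, l', h with
      | [], [], _ => rfl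
      | [], _ :: _, h => exact absurd h.length_eq (by simp)
      | _ :: _, [], h => exact absurd h.length_eq (by simp)
      | _ :: _, _ :: _, h => simp only [powDivDiff, ih h, ih (h.cons x)]
    | swap x y l =>
      simp only [powDivDiff]
      linear_combination sub_mul_powDivDiff N y x l + x * ih (List.Perm.swap x y l)
    | trans _ _ h₁ h₂ => exact h₁.trans h₂

theorem powDivDiff_replicate (N k : ℕ) (x : R) :
    powDivDiff N (List.replicate (k + 1) x) = N.choose k * x ^ (N - k) := by
  induction N generalizing k with
  | zero => cases k <;> simp [powDivDiff, List.replicate_succ]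
  | succ N ih =>
    cases k with
    | zero => simp [powDivDiff]
    | succ k =>
      have hx : (N.choose (k + 1) : R) * x ^ (N - k) =
          x * (N.choose (k + 1) * x ^ (N - (k + 1))) := by
        rcases lt_or_ge k N with hk | hk
        · rw [show N - k = N - (k + 1) + 1 by omega]
          ring
        · simp [Nat.choose_eq_zero_of_lt (Nat.lt_succ_of_le hk)]
      have h₁ := ih k
      have h₂ := ih (k + 1)
      simp only [List.replicate_succ] at h₁ h₂
      simp only [List.replicate_succ, powDivDiff, h₁, h₂, Nat.choose_succ_succ,
        Nat.add_sub_add_right]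
      push_cast
      linear_combination -hx

theorem powDivDiff_eq_zero {N : ℕ} {l : List R} (h : N + 1 < l.length) : powDivDiff N l = 0 := by
  induction N generalizing l with
  | zero =>
    match l, h with
    | _ :: _ :: _, _ => rfl
  | succ N ih =>
    match l, h with
    | _ :: y :: l, h =>
      simp only [List.length_cons] at h
      simp only [powDivDiff]
      rw [ih (by simp; omega), ih (by simp; omega), mul_zero, add_zero]

/-- The divided difference `q[x₁, …, xₘ]` of a polynomial `q` at a list of nodes, which are allowed
to coincide; it is a linear functional of `q`, and it is `0` on the empty list. -/
noncomputable def divDiff (l : List R) : R[X] →ₗ[R] R :=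
  Polynomial.lsum fun N => powDivDiff N l • LinearMap.id

theorem divDiff_monomial (l : List R) (N : ℕ) (a : R) :
    divDiff l (monomial N a) = powDivDiff N l * a := by
  simp [divDiff, Polynomial.lsum_apply]

theorem divDiff_singleton (x : R) (q : R[X]) : divDiff [x] q = q.eval x := by
  induction q using Polynomial.induction_on' with
  | add p q hp hq => simp [hp, hq]
  | monomial N a => simp [divDiff_monomial, powDivDiff, mul_comm]

theorem sub_mul_divDiff (x y : R) (l : List R) (q : R[X]) :
    (x - y) * divDiff (x :: y :: l) q = divDiff (x :: l) q - divDiff (y :: l) q := by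
  induction q using Polynomial.induction_on' with
  | add p q hp hq => simp only [map_add, mul_add, hp, hq]; ring
  | monomial N a =>
    simp only [divDiff_monomial]
    linear_combination a * sub_mul_powDivDiff N x y l

theorem divDiff_perm {l l' : List R} (h : l.Perm l') (q : R[X]) : divDiff l q = divDiff l' q := by
  simp only [divDiff, powDivDiff_perm _ h]

theorem divDiff_X_mul (x y : R) (l : List R) (q : R[X]) :
    divDiff (x :: y :: l) (X * q) = x * divDiff (x :: y :: l) q + divDiff (y :: l) q := by
  induction q using Polynomial.induction_on' with
  | add p q hp hq => simp only [mul_add, map_add, hp, hq]; ring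
  | monomial N a =>
    rw [X_mul_monomial]
    simp only [divDiff_monomial, powDivDiff]
    ring

theorem divDiff_replicate (k : ℕ) (x : R) (q : R[X]) :
    divDiff (List.replicate (k + 1) x) q = (hasseDeriv k q).eval x := by
  induction q using Polynomial.induction_on' with
  | add p q hp hq => simp [hp, hq]
  | monomial N a =>
    simp only [divDiff_monomial, powDivDiff_replicate, hasseDeriv_monomial, eval_monomial]
    ring

theorem divDiff_eq_zero_of_natDegree_lt {l : List R} {q : R[X]} (h : q.natDegree + 1 < l.length) :
    divDiff l q = 0 := by
  rw [divDiff, Polynomial.lsum_apply, Polynomial.sum_over_range _ (by simp)]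
  refine Finset.sum_eq_zero fun N hN => ?_
  rw [powDivDiff_eq_zero (by grind), zero_smul, LinearMap.zero_apply]

end DivDiff

/-! ### Peano kernels of divided differences -/

section Peano

variable {c d : ℝ}

theorem integral_iterate_derivative_mul_sub_pow (m : ℕ) (q : ℝ[X])
    (hq : ∀ j ≤ m, (derivative^[j] q).eval c = 0) (x : ℝ) :
    ∫ s in c..x, (derivative^[m + 1] q).eval s * (x - s) ^ m = m.factorial * q.eval x := by
  have hderiv (k : ℕ) (s : ℝ) :
      HasDerivAt (fun s => (derivative^[k] q).eval s) ((derivative^[k + 1] q).eval s) s := by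
    simpa only [Function.iterate_succ_apply'] using (derivative^[k] q).hasDerivAt s
  induction m with
  | zero =>
    have h := intervalIntegral.integral_eq_sub_of_hasDerivAt (fun s _ => hderiv 0 s)
      ((derivative^[1] q).continuous.intervalIntegrable c x)
    have hc : q.eval c = 0 := hq 0 le_rfl
    simpa [hc] using h
  | succ m ih =>
    have hpow (s : ℝ) : HasDerivAt (fun s => (x - s) ^ (m + 1)) (-((m + 1) * (x - s) ^ m)) s := by
      refine (((hasDerivAt_id s).const_sub x).fun_pow (m + 1)).congr_deriv ?_
      simp
    have hparts := intervalIntegral.integral_mul_deriv_eq_deriv_mul (a := c) (b := x)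
      (fun s _ => hpow s) (fun s _ => hderiv (m + 1) s)
      ((by fun_prop : Continuous fun s => -((m + 1) * (x - s) ^ m)).intervalIntegrable c x)
      ((derivative^[m + 2] q).continuous.intervalIntegrable c x)
    calc ∫ s in c..x, (derivative^[m + 2] q).eval s * (x - s) ^ (m + 1)
        = ∫ s in c..x, (x - s) ^ (m + 1) * (derivative^[m + 2] q).eval s := by
          simp only [mul_comm]
      _ = (m + 1) * ∫ s in c..x, (derivative^[m + 1] q).eval s * (x - s) ^ m := by
          rw [hparts, hq _ le_rfl, ← intervalIntegral.integral_const_mul, sub_self,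
            zero_pow m.succ_ne_zero, zero_mul, mul_zero, sub_zero, zero_sub,
            ← intervalIntegral.integral_neg]
          exact intervalIntegral.integral_congr fun s _ => by ring
      _ = (m + 1).factorial * q.eval x := by
          rw [ih fun j hj => hq j (hj.trans m.le_succ), Nat.factorial_succ]
          push_cast
          ring

/-- `K` is the Peano kernel on `[c, d]` of twice the divided difference at the nodes `l`: it
represents this functional as an integral against the third derivative, on polynomials vanishing to
third order at `c`. The kernel is the divided difference at `l` of `x ↦ (x - s)₊ ^ 2`. -/
def IsPeanoKernel (c d : ℝ) (l : List ℝ) (K : ℝ → ℝ) : Prop :=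
  ∀ q : ℝ[X], (∀ j < 3, (derivative^[j] q).eval c = 0) →
    IntervalIntegrable (fun s => (derivative^[3] q).eval s * K s) volume c d ∧
      ∫ s in c..d, (derivative^[3] q).eval s * K s = 2 * divDiff l q

theorem IsPeanoKernel.rotate {x : ℝ} {l : List ℝ} {K : ℝ → ℝ}
    (h : IsPeanoKernel c d (l ++ [x]) K) : IsPeanoKernel c d (x :: l) K :=
  fun q hq => divDiff_perm (List.perm_append_singleton x l) q ▸ h q hq

theorem IsPeanoKernel.cons_cons {x y : ℝ} {l : List ℝ} {K K₁ K₂ : ℝ → ℝ} (hxy : x ≠ y)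
    (h₁ : IsPeanoKernel c d (x :: l) K₁) (h₂ : IsPeanoKernel c d (y :: l) K₂)
    (hK : ∀ s, (x - y) * K s = K₁ s - K₂ s) : IsPeanoKernel c d (x :: y :: l) K := by
  intro q hq
  have hxy' : x - y ≠ 0 := sub_ne_zero.2 hxy
  have hfun : (fun s => (derivative^[3] q).eval s * K s) = fun s =>
      (x - y)⁻¹ * ((derivative^[3] q).eval s * K₁ s - (derivative^[3] q).eval s * K₂ s) := by
    funext s
    rw [← mul_sub, ← hK]
    field_simp
  obtain ⟨i₁, e₁⟩ := h₁ q hq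
  obtain ⟨i₂, e₂⟩ := h₂ q hq
  rw [hfun]
  refine ⟨(i₁.sub i₂).const_mul _, ?_⟩
  rw [intervalIntegral.integral_const_mul, intervalIntegral.integral_sub i₁ i₂, e₁, e₂, ← mul_sub,
    ← sub_mul_divDiff]
  field_simp

theorem isPeanoKernel_replicate {k : ℕ} (hk : k ≤ 2) {x : ℝ} (hx : x ∈ Set.Icc c d) {K : ℝ → ℝ}
    (hK : ∀ s, K s = if s < x then (Nat.choose 2 k : ℝ) * (x - s) ^ (2 - k) else 0) :
    IsPeanoKernel c d (List.replicate (k + 1) x) K := by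
  intro q hq
  set g : ℝ → ℝ := fun s =>
    (derivative^[3] q).eval s * ((Nat.choose 2 k : ℝ) * (x - s) ^ (2 - k)) with hg
  have hfun : (fun s => (derivative^[3] q).eval s * K s) = (Set.Iio x).indicator g := by
    funext s
    simp [Set.indicator_apply, hg, hK]
  have hcx : Set.EqOn ((Set.Iio x).indicator g) g (Set.uIoo c x) := by
    intro s hs
    rw [Set.uIoo_of_le hx.1] at hs
    exact Set.indicator_of_mem (Set.mem_Iio.2 hs.2) g
  have hxd : Set.EqOn ((Set.Iio x).indicator g) 0 (Set.uIoo x d) := by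
    intro s hs
    rw [Set.uIoo_of_le hx.2] at hs
    exact Set.indicator_of_notMem (Set.notMem_Iio.2 hs.1.le) g
  have icx : IntervalIntegrable ((Set.Iio x).indicator g) volume c x :=
    ((by fun_prop : Continuous g).intervalIntegrable c x).congr_uIoo hcx.symm
  have ixd : IntervalIntegrable ((Set.Iio x).indicator g) volume x d :=
    (intervalIntegrable_const (c := (0 : ℝ))).congr_uIoo hxd.symm
  have hTaylor := integral_iterate_derivative_mul_sub_pow (2 - k) (derivative^[k] q)
    (fun j hj => by rw [← Function.iterate_add_apply]; exact hq _ (by omega)) x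
  rw [← Function.iterate_add_apply, show 2 - k + 1 + k = 3 by omega] at hTaylor
  have hhasse : k.factorial * (hasseDeriv k q).eval x = (derivative^[k] q).eval x := by
    rw [← factorial_smul_hasseDeriv]
    simp
  have hchoose := Nat.choose_mul_factorial_mul_factorial hk
  rw [hfun]
  refine ⟨icx.trans ixd, ?_⟩
  rw [← intervalIntegral.integral_add_adjacent_intervals icx ixd,
    intervalIntegral.integral_congr_uIoo hcx, intervalIntegral.integral_congr_uIoo hxd, hg]
  simp only [mul_left_comm _ (Nat.choose 2 k : ℝ), intervalIntegral.integral_const_mul, hTaylor,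
    Pi.zero_apply, intervalIntegral.integral_zero, add_zero, divDiff_replicate, ← hhasse]
  rw [← mul_assoc, ← mul_assoc, ← Nat.cast_mul, ← Nat.cast_mul, mul_right_comm, hchoose]
  norm_num

/-- Polynomials of degree at most `2` contribute to neither side, so that the vanishing condition
at `c` can be dropped for at least four nodes. -/
theorem IsPeanoKernel.intervalIntegrable_and_integral_eq {l : List ℝ} {K : ℝ → ℝ}
    (h : IsPeanoKernel c d l K) (hl : 3 < l.length) (q : ℝ[X]) :
    IntervalIntegrable (fun s => (derivative^[3] q).eval s * K s) volume c d ∧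
      ∫ s in c..d, (derivative^[3] q).eval s * K s = 2 * divDiff l q := by
  have hmonic : ((X - C c) ^ 3).Monic := (monic_X_sub_C c).pow 3
  set T := q %ₘ (X - C c) ^ 3
  have hdeg : T.natDegree < 3 := by
    have := natDegree_modByMonic_lt q hmonic (fun h => by simpa using congrArg natDegree h)
    simpa using this
  have hdvd : (X - C c) ^ 3 ∣ q - T := ⟨q /ₘ (X - C c) ^ 3, by
    rw [sub_eq_iff_eq_add', modByMonic_add_div q]⟩
  have hvanish (j : ℕ) (hj : j < 3) : (derivative^[j] (q - T)).eval c = 0 := by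
    refine dvd_iff_isRoot.1 (dvd_trans ?_ (pow_sub_dvd_iterate_derivative_of_pow_dvd j hdvd))
    exact dvd_pow_self _ (by omega)
  have key := h (q - T) hvanish
  rwa [iterate_derivative_sub, iterate_derivative_eq_zero hdeg, sub_zero, map_sub,
    divDiff_eq_zero_of_natDegree_lt (by omega : T.natDegree + 1 < l.length), sub_zero] at key

end Peano

/-! ### Divided differences of the truncated square -/

section Spline

/-- The divided difference of `u ↦ (u - s)₊ ^ 2` at `[x]`. -/
noncomputable def truncSq (s x : ℝ) : ℝ := if s < x then (x - s) ^ 2 else 0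

/-- The divided difference of `u ↦ (u - s)₊ ^ 2` at `[x, y]`. -/
noncomputable def splineKer₁ (s x y : ℝ) : ℝ :=
  if s < x then (if s < y then (x - s) + (y - s) else (x - s) ^ 2 / (x - y))
  else (if s < y then (y - s) ^ 2 / (y - x) else 0)

/-- The divided difference of `u ↦ (u - s)₊ ^ 2` at `[x, y, z]`. -/
noncomputable def splineKer₂ (s x y z : ℝ) : ℝ :=
  if s < x then
    if s < y then
      if s < z then 1 else 1 - (s - z) ^ 2 / ((x - z) * (y - z))
    else
      if s < z then 1 - (s - y) ^ 2 / ((x - y) * (z - y)) else (x - s) ^ 2 / ((x - y) * (x - z))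
  else
    if s < y then
      if s < z then 1 - (s - x) ^ 2 / ((y - x) * (z - x)) else (y - s) ^ 2 / ((y - x) * (y - z))
    else
      if s < z then (z - s) ^ 2 / ((z - x) * (z - y)) else 0

/-- The non-negative coefficient which the pair `x, z` of opposite nodes in a cycle `x, y, z, w`
contributes to the divided difference of `u ↦ (u - s)₊ ^ 2`. Every unordered pair is met twice when
the cycle is rotated, so the two equal shares of a pair on one side of `s` have a factor `1 / 2`,
while a pair separated by `s` contributes once. -/
noncomputable def pairCoeff (s x z : ℝ) : ℝ :=
  if s < x then
    if s < z then ((x - s) + (z - s)) / 2 else 1 / (x - z)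
  else
    if s < z then 0 else ((s - x) + (s - z)) / 2

/-- The factor of the path `x, y, z` in the divided difference of `u ↦ (u - s)₊ ^ 2` at a cycle
through `x, y, z`; the path back from `z` to `x` has a factor of the same form. -/
noncomputable def pathFactor (s x y z : ℝ) : ℝ :=
  if s < x then
    if s < z then (if s < y then 0 else (s - y) / ((x - y) * (z - y)))
    else (if s < y then (s - z) / (y - z) else (x - s) / (x - y))
  else
    if s < y then (y - s) / ((y - x) * (y - z)) else 0

/-- The term of the divided difference of `u ↦ (u - s)₊ ^ 2` at `[x, y, z, w]` that belongs to the
opposite nodes `x` and `z`. It depends on `y` and `w` through a product of two equal functions,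
which is what makes the form `cycleSum` below a sum of squares. -/
noncomputable def cyclicPart (s x y z w : ℝ) : ℝ :=
  pairCoeff s x z * (pathFactor s x y z * pathFactor s x w z)

/-- The divided difference of `u ↦ (u - s)₊ ^ 2` at `[x, y, z, w]`, with value `0` when all four
nodes coincide. -/
noncomputable def splineKer₃ (s x y z w : ℝ) : ℝ :=
  cyclicPart s x y z w + cyclicPart s y z w x + cyclicPart s z w x y + cyclicPart s w x y z

theorem pairCoeff_nonneg (s x z : ℝ) : 0 ≤ pairCoeff s x z := by
  unfold pairCoeff
  split_ifs with hx hz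
  · linarith
  · exact one_div_nonneg.2 (by linarith)
  · exact le_rfl
  · linarith

theorem sub_mul_splineKer₁ (s x y : ℝ) :
    (x - y) * splineKer₁ s x y = truncSq s x - truncSq s y := by
  unfold splineKer₁ truncSq
  split_ifs <;> grind

theorem sub_mul_splineKer₂ (s x y z : ℝ) :
    (x - y) * splineKer₂ s x y z = splineKer₁ s x z - splineKer₁ s y z := by
  unfold splineKer₁ splineKer₂
  split_ifs <;> grind

theorem splineKer₂_rotate (s x y z : ℝ) : splineKer₂ s y z x = splineKer₂ s x y z := by
  unfold splineKer₂
  split_ifs <;> ring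

theorem splineKer₃_rotate (s x y z w : ℝ) : splineKer₃ s y z w x = splineKer₃ s x y z w := by
  unfold splineKer₃
  ring

theorem sub_mul_splineKer₃ (s x y z w : ℝ) :
    (x - y) * splineKer₃ s x y z w = splineKer₂ s x z w - splineKer₂ s y z w := by
  unfold splineKer₃ splineKer₂ cyclicPart pairCoeff pathFactor
  split_ifs <;> first | ring1 | (field_simp (disch := grind); ring1)

theorem splineKer₃_self (s x : ℝ) : splineKer₃ s x x x x = 0 := by
  by_cases hs : s < x <;> simp [splineKer₃, cyclicPart, pathFactor, hs]

variable {c d x y z w : ℝ}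

theorem isPeanoKernel_truncSq (hx : x ∈ Set.Icc c d) :
    IsPeanoKernel c d [x] (truncSq · x) :=
  isPeanoKernel_replicate (k := 0) (by norm_num) hx fun s => by simp [truncSq]

theorem isPeanoKernel_splineKer₁ (hx : x ∈ Set.Icc c d) (hy : y ∈ Set.Icc c d) :
    IsPeanoKernel c d [x, y] (splineKer₁ · x y) := by
  rcases eq_or_ne x y with rfl | hxy
  · refine isPeanoKernel_replicate (k := 1) (by norm_num) hx fun s => ?_
    by_cases hs : s < x <;> simp [splineKer₁, hs, two_mul]
  · exact (isPeanoKernel_truncSq hx).cons_cons hxy (isPeanoKernel_truncSq hy)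
      (sub_mul_splineKer₁ · x y)

theorem isPeanoKernel_splineKer₂_of_ne (hx : x ∈ Set.Icc c d) (hy : y ∈ Set.Icc c d)
    (hz : z ∈ Set.Icc c d) (hxy : x ≠ y) : IsPeanoKernel c d [x, y, z] (splineKer₂ · x y z) :=
  (isPeanoKernel_splineKer₁ hx hz).cons_cons hxy (isPeanoKernel_splineKer₁ hy hz)
    (sub_mul_splineKer₂ · x y z)

theorem isPeanoKernel_splineKer₂ (hx : x ∈ Set.Icc c d) (hy : y ∈ Set.Icc c d)
    (hz : z ∈ Set.Icc c d) : IsPeanoKernel c d [x, y, z] (splineKer₂ · x y z) := by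
  rcases ne_or_eq x y with hxy | rfl
  · exact isPeanoKernel_splineKer₂_of_ne hx hy hz hxy
  rcases ne_or_eq x z with hxz | rfl
  · have h := (isPeanoKernel_splineKer₂_of_ne hx hz hx hxz).rotate (l := [x, z])
    simpa only [splineKer₂_rotate] using h
  · refine isPeanoKernel_replicate (k := 2) (by norm_num) hx fun s => ?_
    by_cases hs : s < x <;> simp [splineKer₂, hs]

theorem isPeanoKernel_splineKer₃_of_ne (hx : x ∈ Set.Icc c d) (hy : y ∈ Set.Icc c d)
    (hz : z ∈ Set.Icc c d) (hw : w ∈ Set.Icc c d) (hxy : x ≠ y) :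
    IsPeanoKernel c d [x, y, z, w] (splineKer₃ · x y z w) :=
  (isPeanoKernel_splineKer₂ hx hz hw).cons_cons hxy (isPeanoKernel_splineKer₂ hy hz hw)
    (sub_mul_splineKer₃ · x y z w)

theorem isPeanoKernel_splineKer₃ (hx : x ∈ Set.Icc c d) (hy : y ∈ Set.Icc c d)
    (hz : z ∈ Set.Icc c d) (hw : w ∈ Set.Icc c d) (hne : ¬(x = y ∧ y = z ∧ z = w)) :
    IsPeanoKernel c d [x, y, z, w] (splineKer₃ · x y z w) := by
  rcases ne_or_eq x y with hxy | rfl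
  · exact isPeanoKernel_splineKer₃_of_ne hx hy hz hw hxy
  rcases ne_or_eq x z with hxz | rfl
  · have h := (isPeanoKernel_splineKer₃_of_ne hx hz hw hx hxz).rotate (l := [x, z, w])
    simpa only [← splineKer₃_rotate _ x x z w] using h
  · have hxw : x ≠ w := fun h => hne ⟨rfl, rfl, h⟩
    have h := ((isPeanoKernel_splineKer₃_of_ne hx hw hx hx hxw).rotate
      (l := [x, w, x])).rotate (l := [x, x, w])
    simpa only [← splineKer₃_rotate _ x x x w, ← splineKer₃_rotate _ x x w x] using h

end Spline

/-! ### Positivity of the quartic form of a third divided difference -/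

section CycleSum

variable {ι : Type*} [Fintype ι]

/-- The sum of `g i j k l` over the closed walks `i, j, k, l, i`, each weighted with the real part
of the product of the entries of `B` along the walk. If `B` is Hermitian, so that a walk and its
reverse have conjugate weights, only real parts are relevant. -/
noncomputable def cycleSum (B : Matrix ι ι ℂ) (g : ι → ι → ι → ι → ℝ) : ℝ :=
  ∑ i, ∑ j, ∑ k, ∑ l, (B i j * B j k * B k l * B l i).re * g i j k l

theorem cycleSum_add (B : Matrix ι ι ℂ) (g h : ι → ι → ι → ι → ℝ) :
    cycleSum B (fun i j k l => g i j k l + h i j k l) = cycleSum B g + cycleSum B h := by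
  simp only [cycleSum, mul_add, Finset.sum_add_distrib]

theorem cycleSum_const_mul (B : Matrix ι ι ℂ) (r : ℝ) (g : ι → ι → ι → ι → ℝ) :
    cycleSum B (fun i j k l => r * g i j k l) = r * cycleSum B g := by
  simp only [cycleSum, Finset.mul_sum, mul_left_comm r]

theorem cycleSum_rotate (B : Matrix ι ι ℂ) (g : ι → ι → ι → ι → ℝ) :
    cycleSum B (fun i j k l => g j k l i) = cycleSum B g := by
  unfold cycleSum
  rw [Finset.sum_comm]
  refine Finset.sum_congr rfl fun j _ => ?_
  rw [Finset.sum_comm]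
  refine Finset.sum_congr rfl fun k _ => ?_
  rw [Finset.sum_comm]
  refine Finset.sum_congr rfl fun l _ => Finset.sum_congr rfl fun i _ => ?_
  congr 2
  ring

theorem integral_cycleSum (B : Matrix ι ι ℂ) {c d : ℝ} {g : ι → ι → ι → ι → ℝ → ℝ}
    (hg : ∀ i j k l, IntervalIntegrable (g i j k l) volume c d) :
    ∫ s in c..d, cycleSum B (fun i j k l => g i j k l s) =
      cycleSum B fun i j k l => ∫ s in c..d, g i j k l s := by
  simp only [cycleSum, ← Fintype.sum_prod_type']
  rw [intervalIntegral.integral_finsetSum fun p _ => (hg _ _ _ _).const_mul _]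
  simp only [intervalIntegral.integral_const_mul]

theorem sum_path_mul_path_nonneg {B : Matrix ι ι ℂ} (hB : B.IsHermitian) (i k : ι) (v : ι → ℝ) :
    0 ≤ ∑ j, ∑ l, (B i j * B j k * B k l * B l i).re * (v j * v l) := by
  have hsquare : ∑ j, ∑ l, (B i j * B j k * B k l * B l i).re * (v j * v l) =
      Complex.normSq (∑ j, (v j : ℂ) * (B i j * B j k)) := by
    rw [← Complex.ofReal_re (Complex.normSq _), ← Complex.mul_conj, map_sum, Finset.sum_mul_sum]
    simp only [Complex.re_sum]
    refine Finset.sum_congr rfl fun j _ => Finset.sum_congr rfl fun l _ => ?_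
    rw [map_mul, map_mul, starRingEnd_apply, starRingEnd_apply, starRingEnd_apply, hB.apply,
      hB.apply, Complex.star_def, Complex.conj_ofReal, mul_comm, ← Complex.re_ofReal_mul]
    congr 1
    push_cast
    ring
  exact hsquare ▸ Complex.normSq_nonneg _

theorem cycleSum_mul_paths_nonneg {B : Matrix ι ι ℂ} (hB : B.IsHermitian) {r : ι → ι → ℝ}
    (hr : ∀ i k, 0 ≤ r i k) (v : ι → ι → ι → ℝ) :
    0 ≤ cycleSum B fun i j k l => r i k * (v i j k * v i l k) := by
  simp only [cycleSum, mul_left_comm _ (r _ _)]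
  refine Finset.sum_nonneg fun i _ => ?_
  rw [Finset.sum_comm]
  refine Finset.sum_nonneg fun k _ => ?_
  simp only [← Finset.mul_sum]
  exact mul_nonneg (hr i k) (sum_path_mul_path_nonneg hB i k fun j => v i j k)

theorem cycleSum_splineKer₃_nonneg {B : Matrix ι ι ℂ} (hB : B.IsHermitian) (s : ℝ) (x : ι → ℝ) :
    0 ≤ cycleSum B fun i j k l => splineKer₃ s (x i) (x j) (x k) (x l) := by
  set g : ι → ι → ι → ι → ℝ := fun i j k l => cyclicPart s (x i) (x j) (x k) (x l)
  have hg : 0 ≤ cycleSum B g :=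
    cycleSum_mul_paths_nonneg hB (fun i k => pairCoeff_nonneg s (x i) (x k))
      fun i j k => pathFactor s (x i) (x j) (x k)
  have h₁ := cycleSum_rotate B g
  have h₂ := (cycleSum_rotate B fun i j k l => g j k l i).trans h₁
  have h₃ := (cycleSum_rotate B fun i j k l => g k l i j).trans h₂
  simp only [splineKer₃, cycleSum_add]
  exact add_nonneg (add_nonneg (add_nonneg hg (h₁ ▸ hg)) (h₂ ▸ hg)) (h₃ ▸ hg)

/-- Where all four nodes coincide the Peano kernel is a point mass, which `splineKer₃` misses; the
second summand restores it. -/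
theorem divDiff_eq_integral_add {c d x y z w : ℝ} (hx : x ∈ Set.Icc c d) (hy : y ∈ Set.Icc c d)
    (hz : z ∈ Set.Icc c d) (hw : w ∈ Set.Icc c d) (q : ℝ[X]) :
    IntervalIntegrable (fun s => (derivative^[3] q).eval s * splineKer₃ s x y z w) volume c d ∧
      divDiff [x, y, z, w] q =
        1 / 2 * (∫ s in c..d, (derivative^[3] q).eval s * splineKer₃ s x y z w) +
          if x = y ∧ y = z ∧ z = w then (derivative^[3] q).eval x / 6 else 0 := by
  split_ifs with h
  · obtain ⟨rfl, rfl, rfl⟩ := h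
    simp only [splineKer₃_self, mul_zero, intervalIntegral.integral_zero, zero_add]
    refine ⟨intervalIntegrable_const, ?_⟩
    have h₃ := divDiff_replicate 3 x q
    have hfact := congrArg (Polynomial.eval x) (congrFun (factorial_smul_hasseDeriv (R := ℝ) 3) q)
    simp only [Nat.factorial, LinearMap.smul_apply, eval_smul] at hfact
    rw [← hfact, ← h₃]
    simp [List.replicate_succ]
  · obtain ⟨hint, heq⟩ :=
      (isPeanoKernel_splineKer₃ hx hy hz hw h).intervalIntegrable_and_integral_eq (by simp) q
    refine ⟨hint, ?_⟩
    rw [heq]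
    ring

theorem cycleSum_divDiff_nonneg {B : Matrix ι ι ℂ} (hB : B.IsHermitian) {c d : ℝ} (hcd : c ≤ d)
    {x : ι → ℝ} (hx : ∀ i, x i ∈ Set.Icc c d) {q : ℝ[X]}
    (hq : ∀ s ∈ Set.Icc c d, 0 ≤ (derivative^[3] q).eval s) :
    0 ≤ cycleSum B fun i j k l => divDiff [x i, x j, x k, x l] q := by
  classical
  have hker (i j k l : ι) := divDiff_eq_integral_add (hx i) (hx j) (hx k) (hx l) q
  have hspline : 0 ≤ cycleSum B fun i j k l =>
      ∫ s in c..d, (derivative^[3] q).eval s * splineKer₃ s (x i) (x j) (x k) (x l) := by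
    rw [← integral_cycleSum B fun i j k l => (hker i j k l).1]
    refine intervalIntegral.integral_nonneg hcd fun s hs => ?_
    rw [cycleSum_const_mul]
    exact mul_nonneg (hq s hs) (cycleSum_splineKer₃_nonneg hB s x)
  have hdiag : 0 ≤ cycleSum B fun i j k l =>
      if x i = x j ∧ x j = x k ∧ x k = x l then (derivative^[3] q).eval (x i) / 6 else 0 := by
    refine (cycleSum_mul_paths_nonneg hB (r := fun i _ => (derivative^[3] q).eval (x i) / 6)
      (fun i _ => div_nonneg (hq _ (hx i)) (by norm_num))
      fun i j k => if x i = x j ∧ x j = x k then 1 else 0).trans_eq ?_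
    congr! 5 with i j k l
    split_ifs <;> grind
  simp only [fun i j k l => (hker i j k l).2, cycleSum_add, cycleSum_const_mul]
  exact add_nonneg (mul_nonneg (by norm_num) hspline) hdiag

end CycleSum

/-! ### Derivatives along a matrix pencil -/

section PencilCoeff

variable {S R : Type*} [CommRing S] [Ring R] [Algebra S R]

/-- The coefficient of `u ^ k` in `q(M + u B)`, where `u` commutes with everything, but `M` and `B`
need not commute. It is `1 / k!` times the `k`-th derivative of `q` at `M` in direction `B`. -/
noncomputable def pencilCoeff (M B : R) (k : ℕ) : S[X] →ₗ[S] R :=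
  (lcoeff R k).restrictScalars S ∘ₗ (aeval (C M + X * C B)).toLinearMap

theorem induction_C_add_X_mul {P : S[X] → Prop} (q : S[X]) (C : ∀ a, P (C a))
    (add : ∀ p q, P p → P q → P (p + q)) (X_mul : ∀ q, P q → P (X * q)) : P q := by
  induction q using Polynomial.induction_on with
  | C a => exact C a
  | add p q hp hq => exact add p q hp hq
  | monomial n a h => simpa only [pow_succ', mul_left_comm] using X_mul _ h

theorem pencilCoeff_zero (M B : R) (q : S[X]) : pencilCoeff M B 0 q = aeval M q := by
  induction q using induction_C_add_X_mul with
  | C a => simp [pencilCoeff, Polynomial.algebraMap_apply]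
  | add p q hp hq => rw [map_add, map_add, hp, hq]
  | X_mul q h =>
    rw [map_mul (aeval M), aeval_X, ← h]
    simp [pencilCoeff, mul_coeff_zero]

theorem pencilCoeff_succ_C (M B : R) (k : ℕ) (a : S) : pencilCoeff M B (k + 1) (C a) = 0 := by
  simp [pencilCoeff, Polynomial.algebraMap_apply, coeff_C_succ]

theorem pencilCoeff_succ_X_mul (M B : R) (k : ℕ) (q : S[X]) :
    pencilCoeff M B (k + 1) (X * q) =
      M * pencilCoeff M B (k + 1) q + B * pencilCoeff M B k q := by
  simp [pencilCoeff, add_mul, mul_assoc]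

theorem map_pencilCoeff {R' : Type*} [Ring R'] [Algebra S R'] (φ : R →ₐ[S] R') (M B : R) (k : ℕ)
    (q : S[X]) : φ (pencilCoeff M B k q) = pencilCoeff (φ M) (φ B) k q := by
  induction q using induction_C_add_X_mul generalizing k with
  | C a => cases k <;> simp [pencilCoeff_zero, pencilCoeff_succ_C]
  | add p q hp hq => simp only [map_add, hp, hq]
  | X_mul q h =>
    cases k with
    | zero => simp only [pencilCoeff_zero, aeval_algHom_apply]
    | succ k => simp only [pencilCoeff_succ_X_mul, map_add, map_mul, h]

end PencilCoeff

theorem hasDerivAt_pencilCoeff {R : Type*} [NormedRing R] [NormedAlgebra ℝ R] (A B : R) (k : ℕ)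
    (q : ℝ[X]) (t : ℝ) :
    HasDerivAt (fun t : ℝ => pencilCoeff (A + t • B) B k q)
      ((k + 1 : ℝ) • pencilCoeff (A + t • B) B (k + 1) q) t := by
  induction q using induction_C_add_X_mul generalizing k with
  | C a => cases k <;> simp [pencilCoeff_zero, pencilCoeff_succ_C, hasDerivAt_const]
  | add p q hp hq => simpa only [map_add, smul_add] using (hp k).fun_add (hq k)
  | X_mul q h =>
    have hM : HasDerivAt (fun t : ℝ => A + t • B) B t := by
      simpa using ((hasDerivAt_id t).smul_const B).const_add A
    cases k with
    | zero =>
      have h₀ := h 0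
      simp only [pencilCoeff_zero] at h₀ ⊢
      simp only [map_mul, aeval_X]
      refine (hM.mul h₀).congr_deriv ?_
      simp [pencilCoeff_succ_X_mul, pencilCoeff_zero, add_comm]
    | succ k =>
      simp only [pencilCoeff_succ_X_mul]
      refine ((hM.mul (h (k + 1))).add ((h k).const_mul B)).congr_deriv ?_
      simp only [mul_smul_comm, smul_add]
      push_cast
      module

section Pencil

variable {ι : Type*} [Fintype ι] [DecidableEq ι]

theorem hasDerivAt_linearMap_pencilCoeff (L : Matrix ι ι ℂ →ₗ[ℝ] ℝ) (A B : Matrix ι ι ℂ) (k : ℕ)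
    (q : ℝ[X]) (t : ℝ) :
    HasDerivAt (fun t : ℝ => L (pencilCoeff (A + t • B) B k q))
      ((k + 1) * L (pencilCoeff (A + t • B) B (k + 1) q)) t := by
  let _ := Matrix.linftyOpNormedRing (n := ι) (α := ℂ)
  let _ := Matrix.linftyOpNormedAlgebra (n := ι) (R := ℝ) (α := ℂ)
  refine ((LinearMap.toContinuousLinearMap L).hasFDerivAt.comp_hasDerivAt t
    (hasDerivAt_pencilCoeff A B k q t)).congr_deriv ?_
  exact L.map_smul _ _

theorem trace_pencilCoeff_one_mul_aeval (M B : Matrix ι ι ℂ) (q r : ℝ[X]) :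
    (pencilCoeff M B 1 q * aeval M r).trace = (B * aeval M (derivative q * r)).trace := by
  induction q using induction_C_add_X_mul generalizing r with
  | C a => simp [pencilCoeff_succ_C]
  | add p q hp hq => simp only [map_add, add_mul, mul_add, Matrix.trace_add, hp, hq]
  | X_mul q h =>
    have hcycle : (M * pencilCoeff M B 1 q * aeval M r).trace =
        (pencilCoeff M B 1 q * aeval M (r * X)).trace := by
      rw [map_mul, aeval_X, mul_assoc, Matrix.trace_mul_comm, mul_assoc]
    rw [pencilCoeff_succ_X_mul, pencilCoeff_zero, add_mul, Matrix.trace_add, hcycle, h, mul_assoc B,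
      ← map_mul, ← Matrix.trace_add, ← mul_add, ← map_add]
    congr 3
    simp only [derivative_mul, derivative_X]
    ring

end Pencil

section Hermitian

variable {n : ℕ} {A B : Matrix (Fin n) (Fin n) ℂ}

theorem isHermitian_add_real_smul (hA : A.IsHermitian) (hB : B.IsHermitian) (t : ℝ) :
    (A + t • B).IsHermitian :=
  hA.add (hB.smul (IsSelfAdjoint.all t))

theorem traceFun_eval {M : Matrix (Fin n) (Fin n) ℂ} (hM : M.IsHermitian) (p : ℝ[X]) :
    traceFun (fun x => p.eval x) M = (aeval M p).trace.re := by
  have hM' : IsSelfAdjoint M := hM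
  rw [traceFun, cfc_polynomial p M hM']

theorem hasDerivAt_re_trace_mul_pencilCoeff (N A B : Matrix (Fin n) (Fin n) ℂ) (k : ℕ) (q : ℝ[X])
    (t : ℝ) :
    HasDerivAt (fun t : ℝ => (N * pencilCoeff (A + t • B) B k q).trace.re)
      ((k + 1) * (N * pencilCoeff (A + t • B) B (k + 1) q).trace.re) t :=
  hasDerivAt_linearMap_pencilCoeff
    (Complex.reLm ∘ₗ Matrix.traceLinearMap (Fin n) ℝ ℂ ∘ₗ LinearMap.mulLeft ℝ N) A B k q t

theorem hasDerivAt_traceFun_eval (hA : A.IsHermitian) (hB : B.IsHermitian) (p : ℝ[X]) (t : ℝ) :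
    HasDerivAt (fun t : ℝ => traceFun (fun x => p.eval x) (A + t • B))
      (B * pencilCoeff (A + t • B) B 0 (derivative p)).trace.re t := by
  have h := hasDerivAt_re_trace_mul_pencilCoeff 1 A B 0 p t
  have htrace := trace_pencilCoeff_one_mul_aeval (A + t • B) B p 1
  simp only [map_one, mul_one] at htrace
  simpa [pencilCoeff_zero, htrace, traceFun_eval (isHermitian_add_real_smul hA hB _)] using h

theorem iteratedDeriv_succ_traceFun_eval (hA : A.IsHermitian) (hB : B.IsHermitian) (p : ℝ[X])
    (k : ℕ) :
    iteratedDeriv (k + 1) (fun t : ℝ => traceFun (fun x => p.eval x) (A + t • B)) =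
      fun t => k.factorial * (B * pencilCoeff (A + t • B) B k (derivative p)).trace.re := by
  induction k with
  | zero =>
    funext t
    rw [zero_add, iteratedDeriv_one, (hasDerivAt_traceFun_eval hA hB p t).deriv, Nat.factorial_zero,
      Nat.cast_one, one_mul]
  | succ k ih =>
    funext t
    rw [iteratedDeriv_succ, ih,
      ((hasDerivAt_re_trace_mul_pencilCoeff B A B k (derivative p) t).const_mul _).deriv,
      Nat.factorial_succ]
    push_cast
    ring

theorem contDiff_traceFun_eval (hA : A.IsHermitian) (hB : B.IsHermitian) (p : ℝ[X]) :
    ContDiff ℝ ∞ fun t : ℝ => traceFun (fun x => p.eval x) (A + t • B) := by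
  refine contDiff_of_differentiable_iteratedDeriv fun m _ => ?_
  cases m with
  | zero =>
    rw [iteratedDeriv_zero]
    exact fun t => (hasDerivAt_traceFun_eval hA hB p t).differentiableAt
  | succ k =>
    rw [iteratedDeriv_succ_traceFun_eval hA hB]
    exact fun t =>
      ((hasDerivAt_re_trace_mul_pencilCoeff B A B k _ t).const_mul _).differentiableAt

end Hermitian

section Diagonal

variable {ι : Type*} [Fintype ι] [DecidableEq ι] (x : ι → ℝ) (B : Matrix ι ι ℂ)

theorem pencilCoeff_succ_diagonal_apply {κ : Type*} [Fintype κ] {k : ℕ} {l : ι} {y : κ → List ℝ}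
    {b : ι → κ → ℂ}
    (h : ∀ (q : ℝ[X]) (j : ι), pencilCoeff (Matrix.diagonal fun i => (x i : ℂ)) B k q j l =
      ∑ p, b j p * (divDiff (x j :: y p) q : ℂ)) (q : ℝ[X]) (i : ι) :
    pencilCoeff (Matrix.diagonal fun i => (x i : ℂ)) B (k + 1) q i l =
      ∑ j, ∑ p, B i j * b j p * (divDiff (x i :: x j :: y p) q : ℂ) := by
  induction q using induction_C_add_X_mul with
  | C a =>
    simp [pencilCoeff_succ_C, divDiff_eq_zero_of_natDegree_lt]
  | add p q hp hq => simp [mul_add, Finset.sum_add_distrib, hp, hq]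
  | X_mul q ih =>
    rw [pencilCoeff_succ_X_mul, Matrix.add_apply, Matrix.diagonal_mul, ih, Matrix.mul_apply]
    simp only [h, Finset.mul_sum, ← Finset.sum_add_distrib]
    refine Finset.sum_congr rfl fun j _ => Finset.sum_congr rfl fun p _ => ?_
    rw [divDiff_X_mul]
    push_cast
    ring

theorem pencilCoeff_zero_diagonal_apply (q : ℝ[X]) (i l : ι) :
    pencilCoeff (Matrix.diagonal fun i => (x i : ℂ)) B 0 q i l =
      (1 : Matrix ι ι ℂ) i l * (divDiff [x i] q : ℂ) := by
  induction q using induction_C_add_X_mul with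
  | C a => simp [pencilCoeff_zero, divDiff_singleton, Matrix.algebraMap_eq_diagonal,
      Matrix.diagonal_apply, Matrix.one_apply]
  | add p q hp hq => simp [mul_add, hp, hq]
  | X_mul q ih =>
    rw [pencilCoeff_zero] at ih ⊢
    rw [map_mul, aeval_X, Matrix.diagonal_mul, ih]
    simp [divDiff_singleton, mul_left_comm]

theorem pencilCoeff_one_diagonal_apply (q : ℝ[X]) (i l : ι) :
    pencilCoeff (Matrix.diagonal fun i => (x i : ℂ)) B 1 q i l =
      B i l * (divDiff [x i, x l] q : ℂ) := by
  rw [pencilCoeff_succ_diagonal_apply (κ := Unit) (y := fun _ => [])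
    (b := fun j _ => (1 : Matrix ι ι ℂ) j l) x B
    fun q j => by rw [Fintype.sum_unique, pencilCoeff_zero_diagonal_apply]]
  simp [Matrix.one_apply]

theorem pencilCoeff_two_diagonal_apply (q : ℝ[X]) (i l : ι) :
    pencilCoeff (Matrix.diagonal fun i => (x i : ℂ)) B 2 q i l =
      ∑ j, B i j * B j l * (divDiff [x i, x j, x l] q : ℂ) := by
  rw [pencilCoeff_succ_diagonal_apply (κ := Unit) (y := fun _ => [x l]) (b := fun j _ => B j l) x B
    fun q j => by rw [Fintype.sum_unique, pencilCoeff_one_diagonal_apply]]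
  simp only [Fintype.sum_unique]

theorem re_trace_mul_pencilCoeff_three_diagonal (q : ℝ[X]) :
    (B * pencilCoeff (Matrix.diagonal fun i => (x i : ℂ)) B 3 q).trace.re =
      cycleSum B fun i j k l => divDiff [x i, x j, x k, x l] q := by
  rw [Matrix.trace_mul_comm, Matrix.trace, Complex.re_sum]
  refine Finset.sum_congr rfl fun i _ => ?_
  rw [Matrix.diag_apply, Matrix.mul_apply]
  simp only [pencilCoeff_succ_diagonal_apply x B
    fun q j => pencilCoeff_two_diagonal_apply x B q j _, Finset.sum_mul, Complex.re_sum]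
  rw [Finset.sum_comm]
  refine Finset.sum_congr rfl fun j _ => ?_
  rw [Finset.sum_comm]
  refine Finset.sum_congr rfl fun k _ => Finset.sum_congr rfl fun l _ => ?_
  rw [← Complex.re_mul_ofReal]
  congr 1
  ring

end Diagonal

section Hermitian

variable {n : ℕ} {A B : Matrix (Fin n) (Fin n) ℂ}

theorem trace_mul_pencilCoeff_conjStarAlgAut (U : Matrix.unitaryGroup (Fin n) ℂ)
    (M B : Matrix (Fin n) (Fin n) ℂ) (k : ℕ) (q : ℝ[X]) :
    (Unitary.conjStarAlgAut ℂ _ U B * pencilCoeff (Unitary.conjStarAlgAut ℂ _ U M)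
      (Unitary.conjStarAlgAut ℂ _ U B) k q).trace = (B * pencilCoeff M B k q).trace := by
  set φ := Unitary.conjStarAlgAut ℂ (Matrix (Fin n) (Fin n) ℂ) U with hφ
  have h : φ (pencilCoeff M B k q) = pencilCoeff (φ M) (φ B) k q :=
    map_pencilCoeff (φ.toAlgEquiv.toAlgHom.restrictScalars ℝ) M B k q
  rw [← h, ← map_mul, hφ, Unitary.conjStarAlgAut_apply, Matrix.trace_mul_comm, ← mul_assoc,
    Unitary.coe_star_mul_self, one_mul]

theorem re_trace_mul_pencilCoeff_three_nonneg {M : Matrix (Fin n) (Fin n) ℂ} (hM : M.IsHermitian)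
    (hB : B.IsHermitian) {c d : ℝ} (hMcd : spectrum ℝ M ⊆ Set.Icc c d) {q : ℝ[X]}
    (hq : ∀ s ∈ Set.Icc c d, 0 ≤ (derivative^[3] q).eval s) :
    0 ≤ (B * pencilCoeff M B 3 q).trace.re := by
  rcases isEmpty_or_nonempty (Fin n) with _ | ⟨⟨i⟩⟩
  · simp [Matrix.trace]
  have hev (i : Fin n) : hM.eigenvalues i ∈ Set.Icc c d :=
    hMcd (hM.eigenvalues_mem_spectrum_real i)
  set φ := Unitary.conjStarAlgAut ℂ (Matrix (Fin n) (Fin n) ℂ) hM.eigenvectorUnitary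
  have hMD : M = φ (Matrix.diagonal fun i => (hM.eigenvalues i : ℂ)) := hM.spectral_theorem
  obtain ⟨B', rfl⟩ : ∃ B', φ B' = B := φ.surjective B
  have hB' : B'.IsHermitian := φ.injective ((map_star φ B').trans hB)
  rw [congrArg (pencilCoeff · (φ B') 3 q) hMD, trace_mul_pencilCoeff_conjStarAlgAut,
    re_trace_mul_pencilCoeff_three_diagonal]
  exact cycleSum_divDiff_nonneg hB' ((hev i).1.trans (hev i).2) hev hq

theorem iteratedDeriv_four_traceFun_eval_nonneg (hA : A.IsHermitian) (hB : B.IsHermitian)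
    {p : ℝ[X]} {c d : ℝ} (hp : ∀ x ∈ Set.Icc c d, 0 ≤ (derivative^[4] p).eval x) {t : ℝ}
    (ht : spectrum ℝ (A + t • B) ⊆ Set.Icc c d) :
    0 ≤ iteratedDeriv 4 (fun t : ℝ => traceFun (fun x => p.eval x) (A + t • B)) t := by
  rw [iteratedDeriv_succ_traceFun_eval hA hB]
  exact mul_nonneg (Nat.cast_nonneg _)
    (re_trace_mul_pencilCoeff_three_nonneg (isHermitian_add_real_smul hA hB t) hB ht hp)

end Hermitian

/-! ### Smooth functions with a non-negative iterated derivative -/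

theorem fwdDiff_iterate_nonneg {h : ℝ} (hh : 0 ≤ h) {k : ℕ} {g : ℝ → ℝ} (hg : ContDiff ℝ ∞ g)
    {c d : ℝ} (hgk : ∀ x ∈ Set.Icc c d, 0 ≤ iteratedDeriv k g x) {x : ℝ} (hc : c ≤ x)
    (hd : x + k * h ≤ d) : 0 ≤ (fwdDiff h)^[k] g x := by
  induction k generalizing g d with
  | zero => simpa using hgk x ⟨hc, by simpa using hd⟩
  | succ k ih =>
    have hgh : ContDiff ℝ ∞ fun y => g (y + h) := hg.comp (contDiff_id.add contDiff_const)
    have hmono : MonotoneOn (iteratedDeriv k g) (Set.Icc c d) := by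
      have hdiff : Differentiable ℝ (iteratedDeriv k g) :=
        hg.differentiable_iteratedDeriv k (by exact_mod_cast WithTop.coe_lt_top _)
      refine monotoneOn_of_deriv_nonneg (convex_Icc c d) hdiff.continuous.continuousOn
        hdiff.differentiableOn fun y hy => ?_
      rw [← iteratedDeriv_succ]
      exact hgk y (interior_subset hy)
    rw [Function.iterate_succ_apply]
    refine ih (d := d - h) (hgh.sub hg) (fun y hy => ?_) (by push_cast at hd; linarith)
    have hderiv : iteratedDeriv k (fwdDiff h g) y =
        iteratedDeriv k g (y + h) - iteratedDeriv k g y := by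
      rw [← congrFun (iteratedDeriv_comp_add_const k g h) y]
      exact iteratedDeriv_sub (hgh.of_le (by exact_mod_cast le_top)).contDiffAt
        (hg.of_le (by exact_mod_cast le_top)).contDiffAt
    rw [hderiv, sub_nonneg]
    exact hmono ⟨hy.1, by linarith [hy.2]⟩ ⟨by linarith [hy.1], by linarith [hy.2]⟩ (by linarith)

theorem intervalIntegral_abs_comp_le {g : ℝ → ℝ} (hg : Integrable g) (x : ℝ) {η : ℝ} (hη : 0 ≤ η)
    {j : ℝ} (hj : 1 ≤ |j|) : ∫ h in (0 : ℝ)..η, |g (x + j * h)| ≤ ∫ y, |g y| := by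
  have hj₀ : j ≠ 0 := abs_pos.1 (zero_lt_one.trans_le hj)
  have hint : Integrable fun h => |g (x + j * h)| :=
    ((hg.comp_add_left x).comp_mul_left' hj₀).abs
  rw [intervalIntegral.integral_of_le hη]
  refine (setIntegral_le_integral hint (.of_forall fun _ => abs_nonneg _)).trans ?_
  rw [Measure.integral_comp_mul_left (fun y => |g (x + y)|) j,
    integral_add_left_eq_self (fun y => |g y|) x, abs_inv, smul_eq_mul]
  exact mul_le_of_le_one_left (integral_nonneg fun _ => abs_nonneg _) (inv_le_one_of_one_le₀ hj)

theorem neg_choose_mul_le_sum_of_iteratedDeriv_nonneg {g : ℝ → ℝ} (hg : ContDiff ℝ ∞ g) {h c d : ℝ}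
    (hh : 0 ≤ h) {k m : ℕ} (hm : m ≤ k)
    (hgk : ∀ x ∈ Set.Icc (c - k * h) (d + k * h), 0 ≤ iteratedDeriv k g x) {x : ℝ}
    (hx : x ∈ Set.Icc c d) :
    -((-1) ^ (k - m) * k.choose m * g x) ≤
      ∑ j ∈ (Finset.range (k + 1)).erase m, k.choose j * |g (x + (j - m : ℝ) * h)| := by
  have hmk : (m : ℝ) * h ≤ k * h := by gcongr
  have hm₀ : 0 ≤ (m : ℝ) * h := by positivity
  have hdiff : 0 ≤ ∑ j ∈ Finset.range (k + 1),
      (-1 : ℝ) ^ (k - j) * k.choose j * g (x + (j - m : ℝ) * h) := by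
    have := fwdDiff_iterate_nonneg hh hg hgk (x := x - m * h) (by linarith [hx.1])
      (by linarith [hx.2])
    rw [fwdDiff_iter_eq_sum_shift] at this
    refine this.trans_eq (Finset.sum_congr rfl fun j _ => ?_)
    rw [zsmul_eq_mul, nsmul_eq_mul]
    push_cast
    ring_nf
  rw [← Finset.add_sum_erase _ _ (Finset.mem_range.2 (Nat.lt_succ_of_le hm)), sub_self, zero_mul,
    add_zero] at hdiff
  refine (neg_le_iff_add_nonneg'.2 hdiff).trans (Finset.sum_le_sum fun j _ => ?_)
  refine (le_abs_self _).trans_eq ?_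
  rw [abs_mul, abs_mul, abs_pow, abs_neg, abs_one, one_pow, one_mul, Nat.abs_cast]

theorem neg_choose_mul_le_integral_abs_of_iteratedDeriv_nonneg {g : ℝ → ℝ} (hg : ContDiff ℝ ∞ g)
    (hgi : Integrable g) {k m : ℕ} (hm : m ≤ k) {c d η : ℝ} (hη : 0 ≤ η)
    (hgk : ∀ x ∈ Set.Icc (c - k * η) (d + k * η), 0 ≤ iteratedDeriv k g x) {x : ℝ}
    (hx : x ∈ Set.Icc c d) :
    η * -((-1) ^ (k - m) * k.choose m * g x) ≤ 2 ^ k * ∫ y, |g y| := by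
  have hint (j : ℕ) :
      IntervalIntegrable (fun h => k.choose j * |g (x + (j - m : ℝ) * h)|) volume 0 η :=
    Continuous.intervalIntegrable (by have := hg.continuous; fun_prop) _ _
  calc η * -((-1) ^ (k - m) * k.choose m * g x)
      = ∫ _ in (0 : ℝ)..η, -((-1) ^ (k - m) * k.choose m * g x) := by
        rw [intervalIntegral.integral_const, sub_zero, smul_eq_mul]
    _ ≤ ∫ h in (0 : ℝ)..η,
          ∑ j ∈ (Finset.range (k + 1)).erase m, k.choose j * |g (x + (j - m : ℝ) * h)| := by
        refine intervalIntegral.integral_mono_on hη intervalIntegrable_const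
          (by simpa only [Finset.sum_fn] using IntervalIntegrable.sum _ fun j _ => hint j)
          fun h hh => ?_
        have hkh : (k : ℝ) * h ≤ k * η := by gcongr; exact hh.2
        exact neg_choose_mul_le_sum_of_iteratedDeriv_nonneg hg hh.1 hm
          (fun y hy => hgk y ⟨by linarith [hy.1], by linarith [hy.2]⟩) hx
    _ = ∑ j ∈ (Finset.range (k + 1)).erase m,
          k.choose j * ∫ h in (0 : ℝ)..η, |g (x + (j - m : ℝ) * h)| := by
        rw [intervalIntegral.integral_finsetSum fun j _ => hint j]
        simp only [intervalIntegral.integral_const_mul]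
    _ ≤ ∑ j ∈ (Finset.range (k + 1)).erase m, k.choose j * ∫ y, |g y| := by
        gcongr with j hj
        refine intervalIntegral_abs_comp_le hgi x hη ?_
        exact_mod_cast Int.one_le_abs
          (sub_ne_zero.2 (Nat.cast_injective.ne (Finset.ne_of_mem_erase hj)))
    _ ≤ ∑ j ∈ Finset.range (k + 1), k.choose j * ∫ y, |g y| :=
        Finset.sum_le_sum_of_subset_of_nonneg (Finset.erase_subset _ _) fun _ _ _ => by positivity
    _ = 2 ^ k * ∫ y, |g y| := by
        rw [← Finset.sum_mul, ← Nat.cast_sum, Nat.sum_range_choose]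
        norm_cast

theorem abs_le_integral_abs_of_iteratedDeriv_nonneg {g : ℝ → ℝ} (hg : ContDiff ℝ ∞ g)
    (hgi : Integrable g) {k : ℕ} (hk : k ≠ 0) {c d η : ℝ} (hη : 0 < η)
    (hgk : ∀ x ∈ Set.Icc (c - k * η) (d + k * η), 0 ≤ iteratedDeriv k g x) {x : ℝ}
    (hx : x ∈ Set.Icc c d) : |g x| ≤ 2 ^ k * (∫ y, |g y|) / η := by
  obtain ⟨k, rfl⟩ := Nat.exists_eq_succ_of_ne_zero hk
  have hbound (m : ℕ) (hm : m ≤ k + 1) :=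
    neg_choose_mul_le_integral_abs_of_iteratedDeriv_nonneg hg hgi hm hη.le hgk hx
  have hlower := hbound (k + 1) le_rfl
  have hupper := hbound k k.le_succ
  simp only [Nat.choose_self, Nat.choose_succ_self_right, Nat.sub_self, Nat.add_sub_cancel_left,
    pow_zero, pow_one, Nat.cast_one, one_mul] at hlower hupper
  rw [le_div_iff₀ hη, mul_comm]
  rcases abs_cases (g x) with ⟨habs, _⟩ | ⟨habs, _⟩ <;> rw [habs]
  · refine le_trans ?_ hupper
    have : 0 ≤ η * (k * g x) := by positivity
    push_cast
    linarith
  · exact hlower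

theorem exists_derivative_eq (q : ℝ[X]) : ∃ p : ℝ[X], derivative p = q := by
  induction q using Polynomial.induction_on' with
  | add p q hp hq =>
    obtain ⟨p, rfl⟩ := hp
    obtain ⟨q, rfl⟩ := hq
    exact ⟨p + q, derivative_add⟩
  | monomial N a =>
    refine ⟨monomial (N + 1) (a / (N + 1)), ?_⟩
    rw [derivative_monomial, Nat.add_sub_cancel, Nat.cast_add_one,
      div_mul_cancel₀ _ (Nat.cast_add_one_ne_zero N)]

theorem exists_polynomial_near_of_iteratedDeriv_nonneg {c d : ℝ} (hcd : c ≤ d) {k : ℕ} {g : ℝ → ℝ}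
    (hg : ContDiff ℝ ∞ g) (hgk : ∀ x ∈ Set.Icc c d, 0 ≤ iteratedDeriv k g x) {ε : ℝ} (hε : 0 < ε) :
    ∃ p : ℝ[X], (∀ x ∈ Set.Icc c d, 0 ≤ (derivative^[k] p).eval x) ∧
      ∀ x ∈ Set.Icc c d, |p.eval x - g x| ≤ ε := by
  induction k generalizing g ε with
  | zero =>
    obtain ⟨p, hp⟩ := exists_polynomial_near_of_continuousOn c d g hg.continuous.continuousOn
      (ε / 2) (half_pos hε)
    simp only [abs_lt, iteratedDeriv_zero, Function.iterate_zero, id_eq] at hp hgk ⊢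
    refine ⟨p + C (ε / 2), fun x hx => ?_, fun x hx => ?_⟩ <;> rw [eval_add, eval_C]
    · linarith [(hp x hx).1, hgk x hx]
    · exact abs_le.2 ⟨by linarith [(hp x hx).1], by linarith [(hp x hx).2]⟩
  | succ k ih =>
    obtain ⟨q, hq, hqg⟩ := ih (contDiff_infty_iff_deriv.1 hg).2
      (fun x hx => iteratedDeriv_succ' (f := g) ▸ hgk x hx)
      (show 0 < ε / (d - c + 1) from div_pos hε (by linarith))
    obtain ⟨p, rfl⟩ := exists_derivative_eq q
    refine ⟨p + C (g c - p.eval c), fun x hx => ?_, fun x hx => ?_⟩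
    · rw [Function.iterate_succ_apply, derivative_add, derivative_C, add_zero]
      exact hq x hx
    · have hderiv (y : ℝ) : HasDerivAt (fun y => p.eval y - g y)
          ((derivative p).eval y - deriv g y) y :=
        (p.hasDerivAt y).sub ((hg.differentiable (by simp)) y).hasDerivAt
      have hmvt := (convex_Icc c d).norm_image_sub_le_of_norm_hasDerivWithin_le
        (fun y _ => (hderiv y).hasDerivWithinAt) hqg (Set.left_mem_Icc.2 hcd) hx
      rw [Real.norm_eq_abs, Real.norm_eq_abs, abs_of_nonneg (sub_nonneg.2 hx.1)] at hmvt
      rw [eval_add, eval_C, show p.eval x + (g c - p.eval c) - g x =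
        p.eval x - g x - (p.eval c - g c) by ring]
      refine hmvt.trans ?_
      rw [div_mul_eq_mul_div, div_le_iff₀ (by linarith)]
      exact mul_le_mul_of_nonneg_left (by linarith [hx.2]) hε.le

/-! ### Polynomial approximation of functions with a non-negative distributional derivative -/

theorem tsupport_iteratedDeriv_subset (k : ℕ) (g : ℝ → ℝ) :
    tsupport (iteratedDeriv k g) ⊆ tsupport g := by
  induction k with
  | zero => rw [iteratedDeriv_zero]
  | succ k ih => exact iteratedDeriv_succ (f := g) ▸ tsupport_deriv_subset.trans ih

section Mollify

open ContinuousLinearMap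
open scoped Convolution

theorem iteratedDeriv_convolution_left {ρ F : ℝ → ℝ} (hρ : ContDiff ℝ ∞ ρ)
    (hρc : HasCompactSupport ρ) (hF : LocallyIntegrable F) (k : ℕ) :
    iteratedDeriv k (ρ ⋆[lsmul ℝ ℝ] F) = iteratedDeriv k ρ ⋆[lsmul ℝ ℝ] F := by
  induction k generalizing ρ with
  | zero => rw [iteratedDeriv_zero, iteratedDeriv_zero]
  | succ k ih =>
    rw [iteratedDeriv_succ', iteratedDeriv_succ', ← ih (contDiff_infty_iff_deriv.1 hρ).2 hρc.deriv]
    congr 1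
    funext x
    exact (hρc.hasDerivAt_convolution_left _ (hρ.of_le (by simp)) hF x).deriv

theorem integral_abs_convolution_le {ρ F : ℝ → ℝ} (hρ : Integrable ρ) (hρ₀ : ∀ x, 0 ≤ ρ x)
    (hρ₁ : ∫ x, ρ x = 1) (hF : Integrable F) :
    ∫ x, |(ρ ⋆[lsmul ℝ ℝ] F) x| ≤ ∫ x, |F x| := by
  calc ∫ x, |(ρ ⋆[lsmul ℝ ℝ] F) x|
      ≤ ∫ x, (ρ ⋆[lsmul ℝ ℝ] fun y => |F y|) x := by
        refine integral_mono (hρ.integrable_convolution _ hF).abs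
          (hρ.integrable_convolution _ hF.abs) fun x => ?_
        simp only [convolution_lsmul]
        refine abs_integral_le_integral_abs.trans_eq (integral_congr_ae (.of_forall fun t => ?_))
        simp only [smul_eq_mul, abs_mul, abs_of_nonneg (hρ₀ t)]
    _ = ∫ x, |F x| := by
        rw [integral_convolution (lsmul ℝ ℝ) hρ hF.abs, hρ₁, lsmul_apply, one_smul]

theorem iteratedDeriv_convolution_nonneg {k : ℕ} {f : ℝ → ℝ} {U K : Set ℝ} (hU : IsOpen U)
    (hf : HasNonnegDistribDeriv k f U) (hKU : K ⊆ U) (hF : LocallyIntegrable (K.indicator f))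
    {ρ : ℝ → ℝ} (hρ : ContDiff ℝ ∞ ρ) (hρ₀ : ∀ x, 0 ≤ ρ x) {r : ℝ}
    (hρr : tsupport ρ ⊆ Metric.closedBall 0 r) {x : ℝ} (hx : Metric.closedBall x r ⊆ K) :
    0 ≤ iteratedDeriv k (ρ ⋆[lsmul ℝ ℝ] K.indicator f) x := by
  set φ : ℝ → ℝ := fun y => ρ (x - y)
  have hφK : tsupport φ ⊆ Metric.closedBall x r := by
    refine closure_minimal (fun y hy => ?_) Metric.isClosed_closedBall
    have hxy := hρr (subset_tsupport ρ hy)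
    rwa [mem_closedBall_zero_iff, Real.norm_eq_abs, abs_sub_comm] at hxy
  have hderiv (y : ℝ) : (-1) ^ k * iteratedDeriv k φ y = iteratedDeriv k ρ (x - y) := by
    simp only [φ, iteratedDeriv_comp_const_sub, smul_eq_mul]
    rw [← mul_assoc, ← mul_pow, neg_one_mul, neg_neg, one_pow, one_mul]
  have hzero {y : ℝ} (hy : y ∉ K) : iteratedDeriv k φ y = 0 :=
    image_eq_zero_of_notMem_tsupport fun h => hy (hx (hφK (tsupport_iteratedDeriv_subset k φ h)))
  have hcompact {s : ℝ → ℝ} {z : ℝ} (hs : tsupport s ⊆ Metric.closedBall z r) :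
      HasCompactSupport s :=
    (isCompact_closedBall z r).of_isClosed_subset (isClosed_tsupport s) hs
  calc 0 ≤ (-1) ^ k * ∫ y in U, f y * iteratedDeriv k φ y :=
        hf.nonneg φ (hρ.comp (contDiff_const.sub contDiff_id)) (hcompact hφK)
          ((hφK.trans hx).trans hKU) fun y => hρ₀ _
    _ = iteratedDeriv k (ρ ⋆[lsmul ℝ ℝ] K.indicator f) x := by
        rw [iteratedDeriv_convolution_left hρ (hcompact hρr) hF, convolution_lsmul_swap,
          ← integral_indicator hU.measurableSet, ← integral_const_mul]
        refine integral_congr_ae (.of_forall fun y => ?_)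
        by_cases hyK : y ∈ K
        · simp [hyK, hKU hyK, ← hderiv, mul_comm, mul_left_comm]
        · simp [hyK, hzero hyK, ← hderiv]

theorem exists_Icc_thickening_subset {U : Set ℝ} (hU : IsOpen U) {c d : ℝ} (hcd : c ≤ d)
    (h : Set.Icc c d ⊆ U) : ∃ η > 0, Set.Icc (c - η) (d + η) ⊆ U := by
  obtain ⟨η, hη, hηU⟩ := isCompact_Icc.exists_cthickening_subset_open hU h
  refine ⟨η, hη, fun x hx => hηU (Metric.mem_cthickening_of_dist_le x (max c (min x d)) η _
    ⟨le_max_left _ _, max_le hcd (min_le_right _ _)⟩ ?_)⟩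
  rw [Real.dist_eq, abs_le]
  constructor <;> grind

theorem exists_contDiffBump_tendsto_zero {η : ℝ} (hη : 0 < η) :
    ∃ φ : ℕ → ContDiffBump (0 : ℝ), (∀ m, (φ m).rOut ≤ η) ∧
      Tendsto (fun m => (φ m).rOut) atTop (𝓝 0) ∧ ∀ m, (φ m).rOut ≤ 2 * (φ m).rIn := by
  have hr (m : ℕ) : 0 < η / (m + 1) := by positivity
  refine ⟨fun m => ⟨η / (m + 1) / 2, η / (m + 1), half_pos (hr m), half_lt_self (hr m)⟩,
    fun m => ?_, ?_, fun m => (mul_div_cancel₀ _ two_ne_zero).ge⟩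
  · exact div_le_self hη.le (by linarith [(Nat.cast_nonneg m : (0 : ℝ) ≤ m)])
  · simpa [Function.comp_def] using
      (tendsto_const_div_atTop_nhds_zero_nat η).comp (tendsto_add_atTop_nat 1)

theorem HasNonnegDistribDeriv.exists_contDiff_tendsto {k : ℕ} (hk : k ≠ 0) {f : ℝ → ℝ}
    {U : Set ℝ} (hU : IsOpen U) (hf : HasNonnegDistribDeriv k f U) {c d : ℝ} (hcd : c ≤ d)
    (hcdU : Set.Icc c d ⊆ U) :
    ∃ (g : ℕ → ℝ → ℝ) (M : ℝ), (∀ m, ContDiff ℝ ∞ (g m)) ∧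
      (∀ m, ∀ x ∈ Set.Icc c d, 0 ≤ iteratedDeriv k (g m) x) ∧
      (∀ m, ∀ x ∈ Set.Icc c d, |g m x| ≤ M) ∧
      ∀ᵐ x, x ∈ Set.Icc c d → Tendsto (fun m => g m x) atTop (𝓝 (f x)) := by
  obtain ⟨δ, hδ, hδU⟩ := exists_Icc_thickening_subset hU hcd hcdU
  set η := δ / (k + 1) with hη
  have hη₀ : 0 < η := by positivity
  have hkη : k * η + η = δ := by rw [hη]; field_simp
  have hkη₀ : 0 ≤ k * η := by positivity
  set F := (Set.Icc (c - δ) (d + δ)).indicator f with hF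
  have hFi : Integrable F := (integrable_indicator_iff measurableSet_Icc).2
    (hf.locallyIntegrableOn.integrableOn_compact_subset hδU isCompact_Icc)
  obtain ⟨φ, hφη, hφ₀, hφ₂⟩ := exists_contDiffBump_tendsto_zero hη₀
  let g : ℕ → ℝ → ℝ := fun m => (φ m).normed volume ⋆[lsmul ℝ ℝ] F
  have hg (m : ℕ) : ContDiff ℝ ∞ (g m) :=
    (φ m).hasCompactSupport_normed.contDiff_convolution_left _ (φ m).contDiff_normed
      hFi.locallyIntegrable
  have hgk (m : ℕ) {x : ℝ} (hx : x ∈ Set.Icc (c - k * η) (d + k * η)) :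
      0 ≤ iteratedDeriv k (g m) x := by
    refine iteratedDeriv_convolution_nonneg hU hf hδU hFi.locallyIntegrable (φ m).contDiff_normed
      (φ m).nonneg_normed ((φ m).tsupport_normed_eq (μ := volume)).subset ?_
    rw [Real.closedBall_eq_Icc]
    exact Set.Icc_subset_Icc (by linarith [hx.1, hφη m]) (by linarith [hx.2, hφη m])
  have hgF (m : ℕ) : ∫ y, |g m y| ≤ ∫ y, |F y| :=
    integral_abs_convolution_le (φ m).integrable_normed (φ m).nonneg_normed
      (φ m).integral_normed hFi
  refine ⟨g, 2 ^ k * (∫ y, |F y|) / η, hg, fun m x hx => hgk m ?_, fun m x hx => ?_, ?_⟩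
  · exact ⟨by linarith [hx.1], by linarith [hx.2]⟩
  · calc |g m x| ≤ 2 ^ k * (∫ y, |g m y|) / η :=
          abs_le_integral_abs_of_iteratedDeriv_nonneg (hg m)
            ((φ m).integrable_normed.integrable_convolution _ hFi) hk hη₀ (fun y => hgk m) hx
      _ ≤ 2 ^ k * (∫ y, |F y|) / η := by have := hgF m; gcongr
  · filter_upwards [ContDiffBump.ae_convolution_tendsto_right_of_locallyIntegrable (φ := φ) hφ₀
      (.of_forall hφ₂) hFi.locallyIntegrable] with x hx hxcd
    have hxδ : x ∈ Set.Icc (c - δ) (d + δ) := ⟨by linarith [hxcd.1], by linarith [hxcd.2]⟩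
    rwa [hF, Set.indicator_of_mem hxδ] at hx

theorem HasNonnegDistribDeriv.exists_polynomial_tendsto {k : ℕ} (hk : k ≠ 0) {f : ℝ → ℝ}
    {U : Set ℝ} (hU : IsOpen U) (hf : HasNonnegDistribDeriv k f U) {c d : ℝ}
    (hcdU : Set.Icc c d ⊆ U) :
    ∃ (p : ℕ → ℝ[X]) (M : ℝ), (∀ m, ∀ x ∈ Set.Icc c d, 0 ≤ (derivative^[k] (p m)).eval x) ∧
      (∀ m, ∀ x ∈ Set.Icc c d, |(p m).eval x| ≤ M) ∧
      ∀ᵐ x, x ∈ Set.Icc c d → Tendsto (fun m => (p m).eval x) atTop (𝓝 (f x)) := by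
  rcases lt_or_ge d c with hdc | hcd
  · exact ⟨0, 0, by simp [hdc]⟩
  obtain ⟨g, M, hg, hgk, hgM, hgf⟩ := hf.exists_contDiff_tendsto hk hU hcd hcdU
  choose p hpk hpg using fun m : ℕ => exists_polynomial_near_of_iteratedDeriv_nonneg hcd (hg m)
    (hgk m) (Nat.one_div_pos_of_nat (n := m))
  refine ⟨p, 1 + M, hpk, fun m x hx => ?_, ?_⟩
  · have hp₁ : |(p m).eval x - g m x| ≤ 1 := (hpg m x hx).trans
      ((div_le_one (by positivity)).2 (by linarith [(Nat.cast_nonneg m : (0 : ℝ) ≤ m)]))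
    calc |(p m).eval x| = |((p m).eval x - g m x) + g m x| := by rw [sub_add_cancel]
      _ ≤ 1 + M := (abs_add_le _ _).trans (add_le_add hp₁ (hgM m x hx))
  · filter_upwards [hgf] with x hx hxcd
    have hpg₀ : Tendsto (fun m => (p m).eval x - g m x) atTop (𝓝 0) :=
      squeeze_zero_norm (fun m => hpg m x hxcd) tendsto_one_div_add_atTop_nhds_zero_nat
    simpa using hpg₀.add (hx hxcd)

end Mollify

/-! ### Eigenvalues of a pencil and null sets -/

theorem exists_nhds_dist_le_of_hasStrictFDerivAt {E F G : Type*} [NormedAddCommGroup E]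
    [NormedSpace ℝ E] [FiniteDimensional ℝ E] [NormedAddCommGroup F] [NormedSpace ℝ F]
    [FiniteDimensional ℝ F] [NormedAddCommGroup G] [NormedSpace ℝ G] {Φ : E × F → G}
    {L : E × F →L[ℝ] G} {w₀ : E × F} (hΦ : HasStrictFDerivAt Φ L w₀)
    (hL : ∀ u, L (u, 0) = 0 → u = 0) :
    ∃ N ∈ 𝓝 w₀, ∃ K : NNReal, ∀ w ∈ N, ∀ w' ∈ N, Φ w = Φ w' → dist w w' ≤ K * dist w.2 w'.2 := by
  obtain ⟨K, hK₀, hK⟩ := LinearMap.exists_antilipschitzWith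
    ((L.prod (ContinuousLinearMap.snd ℝ E F)) : E × F →ₗ[ℝ] G × F) <| by
      rw [LinearMap.ker_eq_bot']
      rintro ⟨u, v⟩ huv
      obtain ⟨hu, rfl : v = 0⟩ := Prod.mk.inj huv
      rw [hL u hu, Prod.mk_zero_zero]
  have hsmall := hΦ.isLittleO.def (show (0 : ℝ) < (2 * (K : ℝ))⁻¹ by positivity)
  rw [nhds_prod_eq, eventually_iff, mem_prod_same_iff] at hsmall
  obtain ⟨N, hN, hNs⟩ := hsmall
  refine ⟨N, hN, K, fun w hw w' hw' hww' => ?_⟩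
  have hLw : ‖L (w - w')‖ ≤ (2 * (K : ℝ))⁻¹ * ‖w - w'‖ := by
    have := hNs (Set.mk_mem_prod hw hw')
    rwa [Set.mem_ofPred, hww', sub_self, zero_sub, norm_neg] at this
  have hanti : ‖w - w'‖ ≤ K * max ‖L (w - w')‖ ‖w.2 - w'.2‖ := by
    have := hK.le_mul_dist (w - w') 0
    rwa [map_zero, dist_zero_right, dist_zero_right, Prod.norm_def] at this
  rw [dist_eq_norm, dist_eq_norm]
  rcases max_cases ‖L (w - w')‖ ‖w.2 - w'.2‖ with ⟨hmax, -⟩ | ⟨hmax, -⟩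
  · have hhalf : ‖w - w'‖ ≤ 1 / 2 * ‖w - w'‖ := calc
      ‖w - w'‖ ≤ K * ((2 * (K : ℝ))⁻¹ * ‖w - w'‖) :=
        (hmax ▸ hanti).trans (mul_le_mul_of_nonneg_left hLw K.2)
      _ = 1 / 2 * ‖w - w'‖ := by field_simp
    linarith [mul_nonneg K.coe_nonneg (norm_nonneg (w.2 - w'.2))]
  · exact hmax ▸ hanti

theorem hausdorffMeasure_fst_image_eq_zero {X Y : Type*} [MetricSpace X] [MeasurableSpace X]
    [BorelSpace X] [MetricSpace Y] [MeasurableSpace Y] [BorelSpace Y] {S : Set (X × Y)}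
    {K : NNReal} (hS : ∀ w ∈ S, ∀ w' ∈ S, dist w w' ≤ K * dist w.2 w'.2) {d : ℝ} (hd : 0 ≤ d)
    (h : μH[d] (Prod.snd '' S) = 0) : μH[d] (Prod.fst '' S) = 0 := by
  borelize ↥S
  have hsnd : AntilipschitzWith K fun w : S => w.1.2 :=
    .of_le_mul_dist fun w w' => hS w w.2 w' w'.2
  have hfst : LipschitzWith 1 fun w : S => w.1.1 := .mk_one fun w w' => le_max_left _ _
  have hnull : μH[d] (Set.univ : Set S) = 0 := by
    refine le_antisymm ((hsnd.le_hausdorffMeasure_image hd Set.univ).trans_eq ?_) bot_le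
    rw [Set.image_univ, ← Set.image_eq_range, h, mul_zero]
  have hle := hfst.hausdorffMeasure_image_le hd Set.univ
  rw [Set.image_univ, ← Set.image_eq_range, hnull, mul_zero] at hle
  exact le_antisymm hle bot_le

theorem contDiff_evalEval_ofReal (Q : ℂ[X][X]) :
    ContDiff ℝ ∞ fun w : ℝ × ℝ => Q.evalEval (w.2 : ℂ) (w.1 : ℂ) := by
  have hfst : ContDiff ℝ ∞ fun w : ℝ × ℝ => (w.1 : ℂ) :=
    Complex.ofRealCLM.contDiff.comp contDiff_fst
  have hsnd : ContDiff ℝ ∞ fun w : ℝ × ℝ => (w.2 : ℂ) :=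
    Complex.ofRealCLM.contDiff.comp contDiff_snd
  simp only [evalEval, eval_eq_sum_range (p := Q), eval_finsetSum, eval_mul, eval_pow, eval_C]
  simp only [eval_eq_sum_range]
  fun_prop

theorem fderiv_evalEval_ofReal (Q : ℂ[X][X]) (w : ℝ × ℝ) (u : ℝ) :
    fderiv ℝ (fun w : ℝ × ℝ => Q.evalEval (w.2 : ℂ) (w.1 : ℂ)) w (u, 0) =
      u * (derivative Q).evalEval (w.2 : ℂ) (w.1 : ℂ) := by
  have hpath : HasDerivAt (fun t : ℝ => ((t, w.2) : ℝ × ℝ)) (1, 0) w.1 :=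
    (hasDerivAt_id w.1).prodMk (hasDerivAt_const w.1 w.2)
  have hcomp := ((contDiff_evalEval_ofReal Q).differentiable (by simp) w).hasFDerivAt
    |>.comp_hasDerivAt w.1 hpath
  have hfst : HasDerivAt (fun t : ℝ => Q.evalEval (w.2 : ℂ) (t : ℂ))
      ((derivative Q).evalEval (w.2 : ℂ) (w.1 : ℂ)) w.1 := by
    simp only [← map_evalRingHom_eval, ← derivative_map]
    exact ((Q.map (evalRingHom (w.2 : ℂ))).hasDerivAt (w.1 : ℂ)).comp_ofReal
  rw [← hcomp.unique hfst, ← Complex.real_smul, ← map_smul]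
  simp

theorem volume_fst_image_simple_zeros (Q : ℂ[X][X]) {Z : Set ℝ} (hZ : volume Z = 0) :
    volume (Prod.fst '' {w : ℝ × ℝ | w.2 ∈ Z ∧ Q.evalEval (w.2 : ℂ) (w.1 : ℂ) = 0 ∧
      (derivative Q).evalEval (w.2 : ℂ) (w.1 : ℂ) ≠ 0}) = 0 := by
  set S := {w : ℝ × ℝ | w.2 ∈ Z ∧ Q.evalEval (w.2 : ℂ) (w.1 : ℂ) = 0 ∧
    (derivative Q).evalEval (w.2 : ℂ) (w.1 : ℂ) ≠ 0}
  refine measure_null_of_locally_null (μ := (volume : Measure ℝ).toOuterMeasure.comap Prod.fst)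
    S fun w₀ hw₀ => ?_
  obtain ⟨N, hN, K, hK⟩ := exists_nhds_dist_le_of_hasStrictFDerivAt
    ((contDiff_evalEval_ofReal Q).contDiffAt.hasStrictFDerivAt (x := w₀) (by simp)) fun u hu => by
      simpa [fderiv_evalEval_ofReal, hw₀.2.2] using hu
  refine ⟨S ∩ N, inter_mem_nhdsWithin S hN, ?_⟩
  rw [OuterMeasure.comap_apply, Measure.coe_toOuterMeasure, ← hausdorffMeasure_real]
  refine hausdorffMeasure_fst_image_eq_zero (K := K) (fun w hw w' hw' => ?_) zero_le_one ?_
  · exact hK w hw.2 w' hw'.2 (hw.1.2.1.trans hw'.1.2.1.symm)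
  · rw [hausdorffMeasure_real]
    exact measure_mono_null (Set.image_subset_iff.2 fun w hw => hw.1.1) hZ

theorem ae_map_evalRingHom_eq_zero_of_evalEval_eq_zero (P : ℂ[X][X]) {Z : Set ℝ}
    (hZ : volume Z = 0) :
    ∀ᵐ t : ℝ, ∀ x ∈ Z, P.evalEval (x : ℂ) (t : ℂ) = 0 → P.map (evalRingHom (x : ℂ)) = 0 := by
  have hsimple : ∀ᵐ t : ℝ, ∀ k : ℕ, t ∉ Prod.fst '' {w : ℝ × ℝ | w.2 ∈ Z ∧
      (derivative^[k] P).evalEval (w.2 : ℂ) (w.1 : ℂ) = 0 ∧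
      (derivative (derivative^[k] P)).evalEval (w.2 : ℂ) (w.1 : ℂ) ≠ 0} :=
    ae_all_iff.2 fun k =>
      compl_mem_ae_iff.2 (volume_fst_image_simple_zeros (derivative^[k] P) hZ)
  filter_upwards [hsimple] with t ht x hx hroot
  by_contra hne
  have hall (k : ℕ) : (derivative^[k] P).evalEval (x : ℂ) (t : ℂ) = 0 := by
    induction k with
    | zero => exact hroot
    | succ k ih =>
      by_contra hk
      rw [Function.iterate_succ_apply'] at hk
      exact ht k ⟨(t, x), ⟨hx, ih, hk⟩, rfl⟩
  refine lt_irrefl _ ((lt_rootMultiplicity_iff_isRoot_iterate_derivative (t := (t : ℂ)) hne).2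
    fun k _ => ?_)
  rw [IsRoot, iterate_derivative_map, map_evalRingHom_eval]
  exact hall k

theorem exists_ae_rootMultiplicity_map_evalRingHom {P : ℂ[X][X]} (hP : P ≠ 0) (x : ℂ) :
    ∃ m : ℕ, ∀ᵐ t : ℝ, (P.map (evalRingHom (t : ℂ))).rootMultiplicity x = m := by
  obtain ⟨R, hPR, hR⟩ := exists_eq_pow_rootMultiplicity_mul_and_not_dvd P hP (C x)
  have hRx : R.eval (C x) ≠ 0 := fun h => hR (dvd_iff_isRoot.2 h)
  have hfin : {t : ℝ | R.evalEval (t : ℂ) x = 0}.Finite := by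
    refine ((R.eval (C x)).roots.toFinset.finite_toSet.preimage
      Complex.ofReal_injective.injOn).subset fun t ht => ?_
    simpa [hRx] using ht
  refine ⟨P.rootMultiplicity (C x), ?_⟩
  filter_upwards [compl_mem_ae_iff.2 (hfin.measure_zero volume)] with t ht
  have hRt : (R.map (evalRingHom (t : ℂ))).eval x ≠ 0 := by rwa [map_evalRingHom_eval]
  have hRt₀ : R.map (evalRingHom (t : ℂ)) ≠ 0 := fun h => hRt (by rw [h, eval_zero])
  have hfactor : P.map (evalRingHom (t : ℂ)) =
      (X - C x) ^ P.rootMultiplicity (C x) * R.map (evalRingHom (t : ℂ)) := by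
    conv_lhs => rw [hPR]
    simp
  rw [hfactor, rootMultiplicity_mul (mul_ne_zero (pow_ne_zero _ (X_sub_C_ne_zero x)) hRt₀),
    rootMultiplicity_X_sub_C_pow, rootMultiplicity_eq_zero hRt, add_zero]

section Eigenvalues

variable {n : ℕ} {A B : Matrix (Fin n) (Fin n) ℂ}

/-- The characteristic polynomial of the pencil `A + t B`: a polynomial in the eigenvalue
variable, whose coefficients are polynomials in `t`. -/
noncomputable def pencilCharpoly (A B : Matrix (Fin n) (Fin n) ℂ) : ℂ[X][X] :=
  (A.map C + (X : ℂ[X]) • B.map C).charpoly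

theorem map_evalRingHom_pencilCharpoly (A B : Matrix (Fin n) (Fin n) ℂ) (t : ℝ) :
    (pencilCharpoly A B).map (evalRingHom (t : ℂ)) = (A + t • B).charpoly := by
  rw [pencilCharpoly, ← Matrix.charpoly_map]
  congr 1
  ext i j
  simpa using mul_comm (B i j) (t : ℂ)

theorem mem_spectrum_real_iff_isRoot_charpoly (M : Matrix (Fin n) (Fin n) ℂ) (x : ℝ) :
    x ∈ spectrum ℝ M ↔ M.charpoly.IsRoot (x : ℂ) := by
  rw [← spectrum.algebraMap_mem_iff ℂ, Matrix.mem_spectrum_iff_isRoot_charpoly]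
  rfl

theorem mem_spectrum_pencil_iff (A B : Matrix (Fin n) (Fin n) ℂ) (t x : ℝ) :
    x ∈ spectrum ℝ (A + t • B) ↔
      (Bivariate.swap (pencilCharpoly A B)).evalEval (x : ℂ) (t : ℂ) = 0 := by
  have hswap := Bivariate.aevalAeval_swap (x : ℂ) (t : ℂ) (pencilCharpoly A B)
  rw [coe_aevalAeval_eq_evalEval, coe_aevalAeval_eq_evalEval] at hswap
  rw [hswap, ← map_evalRingHom_eval, map_evalRingHom_pencilCharpoly,
    mem_spectrum_real_iff_isRoot_charpoly, IsRoot]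

theorem ae_forall_mem_spectrum_pencil (A B : Matrix (Fin n) (Fin n) ℂ) {Z : Set ℝ}
    (hZ : volume Z = 0) :
    ∀ᵐ t : ℝ, ∀ x ∈ Z, x ∈ spectrum ℝ (A + t • B) → ∀ t' : ℝ, x ∈ spectrum ℝ (A + t' • B) := by
  filter_upwards [ae_map_evalRingHom_eq_zero_of_evalEval_eq_zero
    (Bivariate.swap (pencilCharpoly A B)) hZ] with t ht x hx hxt t'
  rw [mem_spectrum_pencil_iff] at hxt ⊢
  rw [← map_evalRingHom_eval, ht x hx hxt, eval_zero]

theorem exists_ae_rootMultiplicity_charpoly_pencil (A B : Matrix (Fin n) (Fin n) ℂ) (x : ℂ) :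
    ∃ m : ℕ, ∀ᵐ t : ℝ, (A + t • B).charpoly.rootMultiplicity x = m := by
  simpa only [map_evalRingHom_pencilCharpoly] using
    exists_ae_rootMultiplicity_map_evalRingHom (P := pencilCharpoly A B)
      (Matrix.charpoly_monic _).ne_zero x

theorem traceFun_eq_sum_eigenvalues {M : Matrix (Fin n) (Fin n) ℂ} (hM : M.IsHermitian)
    (h : ℝ → ℝ) : traceFun h M = ∑ i, h (hM.eigenvalues i) := by
  rw [traceFun, hM.cfc_eq, Matrix.IsHermitian.cfc, Unitary.conjStarAlgAut_apply,
    Matrix.trace_mul_comm, ← mul_assoc, Unitary.coe_star_mul_self, one_mul, Matrix.trace_diagonal,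
    Complex.re_sum]
  rfl

theorem traceFun_sub {M : Matrix (Fin n) (Fin n) ℂ} (hM : M.IsHermitian) (f g : ℝ → ℝ) :
    traceFun (fun x => f x - g x) M = traceFun f M - traceFun g M := by
  simp only [traceFun_eq_sum_eigenvalues hM, Finset.sum_sub_distrib]

theorem abs_traceFun_le {M : Matrix (Fin n) (Fin n) ℂ} (hM : M.IsHermitian) {h : ℝ → ℝ} {C : ℝ}
    (hC : ∀ x ∈ spectrum ℝ M, |h x| ≤ C) : |traceFun h M| ≤ n * C := by
  rw [traceFun_eq_sum_eigenvalues hM]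
  calc |∑ i, h (hM.eigenvalues i)| ≤ ∑ i, |h (hM.eigenvalues i)| := Finset.abs_sum_le_sum_abs _ _
    _ ≤ ∑ _i : Fin n, C :=
      Finset.sum_le_sum fun i _ => hC _ (hM.eigenvalues_mem_spectrum_real i)
    _ = n * C := by rw [Fin.sum_const, nsmul_eq_mul]

theorem tendsto_traceFun {ι : Type*} {l : Filter ι} {M : Matrix (Fin n) (Fin n) ℂ}
    (hM : M.IsHermitian) {h : ι → ℝ → ℝ} {f : ℝ → ℝ}
    (hf : ∀ x ∈ spectrum ℝ M, Tendsto (fun m => h m x) l (𝓝 (f x))) :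
    Tendsto (fun m => traceFun (h m) M) l (𝓝 (traceFun f M)) := by
  simp only [traceFun_eq_sum_eigenvalues hM]
  exact tendsto_finsetSum _ fun i _ => hf _ (hM.eigenvalues_mem_spectrum_real i)

theorem card_eigenvalues_eq {M : Matrix (Fin n) (Fin n) ℂ} (hM : M.IsHermitian) (x : ℝ) :
    (Finset.univ.filter fun i => hM.eigenvalues i = x).card =
      M.charpoly.rootMultiplicity (x : ℂ) := by
  rw [← count_roots, hM.roots_charpoly_eq_eigenvalues, Multiset.count_map, Finset.card_def]
  congr 1
  simp [eq_comm]

theorem traceFun_eq_sum_rootMultiplicity {M : Matrix (Fin n) (Fin n) ℂ} (hM : M.IsHermitian)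
    {h : ℝ → ℝ} {Λ : Finset ℝ} (hΛ : ∀ x ∈ spectrum ℝ M, x ∉ Λ → h x = 0) :
    traceFun h M = ∑ x ∈ Λ, M.charpoly.rootMultiplicity (x : ℂ) * h x := by
  have hsingle (i : Fin n) :
      h (hM.eigenvalues i) = ∑ x ∈ Λ, if hM.eigenvalues i = x then h x else 0 := by
    rw [Finset.sum_ite_eq]
    split_ifs with hi
    · rfl
    · exact hΛ _ (hM.eigenvalues_mem_spectrum_real i) hi
  rw [traceFun_eq_sum_eigenvalues hM, Finset.sum_congr rfl fun i _ => hsingle i, Finset.sum_comm]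
  refine Finset.sum_congr rfl fun x _ => ?_
  rw [← Finset.sum_filter, Finset.sum_const, card_eigenvalues_eq hM, nsmul_eq_mul]

-- For almost all `t`, the eigenvalues of `A + t B` in a null set are common to the whole pencil.
theorem exists_ae_traceFun_eq_const (hA : A.IsHermitian) (hB : B.IsHermitian) {h : ℝ → ℝ}
    (hh : ∀ᵐ x, h x = 0) : ∃ s : ℝ, ∀ᵐ t : ℝ, traceFun h (A + t • B) = s := by
  choose m hm using fun x : ℝ => exists_ae_rootMultiplicity_charpoly_pencil A B (x : ℂ)
  set Λ := A.finite_real_spectrum.toFinset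
  refine ⟨∑ x ∈ Λ, m x * h x, ?_⟩
  filter_upwards [ae_forall_mem_spectrum_pencil A B (ae_iff.1 hh),
    (Finset.eventually_all Λ).2 fun x _ => hm x] with t hspec hmult
  rw [traceFun_eq_sum_rootMultiplicity (isHermitian_add_real_smul hA hB t) fun x hx hxΛ => ?_]
  · exact Finset.sum_congr rfl fun x hx => by rw [hmult x hx]
  · by_contra hne
    exact hxΛ (A.finite_real_spectrum.mem_toFinset.2 (by simpa using hspec x hne hx 0))

theorem exists_ae_traceFun_eq_add_const (hA : A.IsHermitian) (hB : B.IsHermitian) {f g : ℝ → ℝ}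
    (hfg : f =ᵐ[volume] g) :
    ∃ s : ℝ, ∀ᵐ t : ℝ, traceFun f (A + t • B) = traceFun g (A + t • B) + s := by
  obtain ⟨s, hs⟩ := exists_ae_traceFun_eq_const hA hB (hfg.mono fun x hx => sub_eq_zero.2 hx)
  refine ⟨s, hs.mono fun t ht => ?_⟩
  rw [← ht, traceFun_sub (isHermitian_add_real_smul hA hB t), add_sub_cancel]

/-! ### The domain of a pencil -/

theorem isClosed_setOf_mem_spectrum_pencil (A B : Matrix (Fin n) (Fin n) ℂ) :
    IsClosed {w : ℝ × ℝ | w.2 ∈ spectrum ℝ (A + w.1 • B)} := by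
  simp only [mem_spectrum_pencil_iff]
  exact isClosed_eq (contDiff_evalEval_ofReal _).continuous continuous_const

theorem sq_le_traceFun_sq {M : Matrix (Fin n) (Fin n) ℂ} (hM : M.IsHermitian) {x : ℝ}
    (hx : x ∈ spectrum ℝ M) : x ^ 2 ≤ traceFun (fun y => y ^ 2) M := by
  rw [hM.spectrum_real_eq_range_eigenvalues] at hx
  obtain ⟨i, rfl⟩ := hx
  rw [traceFun_eq_sum_eigenvalues hM]
  exact Finset.single_le_sum (f := fun i => hM.eigenvalues i ^ 2) (fun i _ => sq_nonneg _)
    (Finset.mem_univ i)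

theorem isCompact_setOf_mem_spectrum_pencil (hA : A.IsHermitian) (hB : B.IsHermitian) {K : Set ℝ}
    (hK : IsCompact K) : IsCompact {w : ℝ × ℝ | w.1 ∈ K ∧ w.2 ∈ spectrum ℝ (A + w.1 • B)} := by
  obtain ⟨R, hR⟩ := hK.bddAbove_image
    (contDiff_traceFun_eval hA hB (X ^ 2 : ℝ[X])).continuous.continuousOn
  refine (hK.prod (isCompact_Icc (a := -√R) (b := √R))).of_isClosed_subset
    ((hK.isClosed.preimage continuous_fst).inter (isClosed_setOf_mem_spectrum_pencil A B)) ?_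
  rintro ⟨t, x⟩ ⟨ht, hx⟩
  have hRt : traceFun (fun y => y ^ 2) (A + t • B) ≤ R := by simpa using hR ⟨t, ht, rfl⟩
  exact ⟨ht, abs_le.1 (Real.abs_le_sqrt
    ((sq_le_traceFun_sq (isHermitian_add_real_smul hA hB t) hx).trans hRt))⟩

theorem isOpen_pencilDomain (hA : A.IsHermitian) (hB : B.IsHermitian) {I : Set ℝ}
    (hI : IsOpen I) : IsOpen (pencilDomain I A B) := by
  rw [isOpen_iff_mem_nhds]
  intro t₀ ht₀
  set G := {w : ℝ × ℝ | w.1 ∈ Metric.closedBall t₀ 1 ∧ w.2 ∈ spectrum ℝ (A + w.1 • B)}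
  have hbad : IsCompact (Prod.fst '' (G ∩ Prod.snd ⁻¹' Iᶜ)) :=
    ((isCompact_setOf_mem_spectrum_pencil hA hB (isCompact_closedBall t₀ 1)).inter_right
      (hI.isClosed_compl.preimage continuous_snd)).image continuous_fst
  have ht₀bad : t₀ ∉ Prod.fst '' (G ∩ Prod.snd ⁻¹' Iᶜ) := by
    rintro ⟨w, ⟨⟨_, hw⟩, hwI⟩, rfl⟩
    exact hwI (ht₀ hw)
  filter_upwards [hbad.isClosed.isOpen_compl.mem_nhds ht₀bad,
    Metric.closedBall_mem_nhds t₀ zero_lt_one] with t ht htb x hx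
  by_contra hxI
  exact ht ⟨(t, x), ⟨⟨htb, hx⟩, hxI⟩, rfl⟩

theorem exists_isCompact_subset_pencilDomain (hA : A.IsHermitian) (hB : B.IsHermitian)
    {I K : Set ℝ} (hK : IsCompact K) (hKI : K ⊆ pencilDomain I A B) :
    ∃ S ⊆ I, IsCompact S ∧ K ⊆ pencilDomain S A B := by
  refine ⟨Prod.snd '' {w : ℝ × ℝ | w.1 ∈ K ∧ w.2 ∈ spectrum ℝ (A + w.1 • B)}, ?_,
    (isCompact_setOf_mem_spectrum_pencil hA hB hK).image continuous_snd,
    fun t ht x hx => ⟨(t, x), ⟨ht, hx⟩, rfl⟩⟩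
  rintro _ ⟨w, ⟨ht, hx⟩, rfl⟩
  exact hKI ht hx

end Eigenvalues

theorem isOpen_realInterval (a b : EReal) : IsOpen (realInterval a b) :=
  (isOpen_Ioo (a := a) (b := b)).preimage continuous_coe_real_ereal

theorem ordConnected_realInterval (a b : EReal) : (realInterval a b).OrdConnected :=
  ⟨fun _ hx _ hy _ hz => ⟨hx.1.trans_le (EReal.coe_le_coe_iff.2 hz.1),
    (EReal.coe_le_coe_iff.2 hz.2).trans_lt hy.2⟩⟩

theorem exists_subset_Ioo_of_isCompact_subset {I S : Set ℝ} (hI : IsOpen I) (hIc : I.OrdConnected)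
    (hS : IsCompact S) (hSI : S ⊆ I) : ∃ c d, S ⊆ Set.Ioo c d ∧ Set.Icc c d ⊆ I := by
  rcases S.eq_empty_or_nonempty with rfl | hne
  · exact ⟨1, 0, Set.empty_subset _, by simp⟩
  · have hle {x : ℝ} (hx : x ∈ S) : sInf S ≤ x ∧ x ≤ sSup S :=
      ⟨csInf_le hS.bddBelow hx, le_csSup hS.bddAbove hx⟩
    have hIcc : Set.Icc (sInf S) (sSup S) ⊆ I :=
      hIc.out (hSI (hS.sInf_mem hne)) (hSI (hS.sSup_mem hne))
    obtain ⟨η, hη, hηI⟩ := exists_Icc_thickening_subset hI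
      ((hle hne.some_mem).1.trans (hle hne.some_mem).2) hIcc
    exact ⟨_, _, fun x hx => ⟨(sub_lt_self _ hη).trans_le (hle hx).1,
      (hle hx).2.trans_lt (lt_add_of_pos_right _ hη)⟩, hηI⟩

/-! ### Stability of non-negative distributional derivatives -/

theorem hasCompactSupport_iteratedDeriv {φ : ℝ → ℝ} (hφ : HasCompactSupport φ) (k : ℕ) :
    HasCompactSupport (iteratedDeriv k φ) :=
  hφ.of_isClosed_subset (isClosed_tsupport _) (tsupport_iteratedDeriv_subset k φ)

theorem contDiff_iteratedDeriv {φ : ℝ → ℝ} (hφ : ContDiff ℝ ∞ φ) (k : ℕ) :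
    ContDiff ℝ ∞ (iteratedDeriv k φ) :=
  iteratedDeriv_eq_iterate (f := φ) ▸ hφ.iterate_deriv k

theorem integral_mul_iteratedDeriv {u φ : ℝ → ℝ} (hu : ContDiff ℝ ∞ u) (hφ : ContDiff ℝ ∞ φ)
    (hφc : HasCompactSupport φ) (k : ℕ) :
    ∫ t, u t * iteratedDeriv k φ t = (-1) ^ k * ∫ t, iteratedDeriv k u t * φ t := by
  induction k generalizing u with
  | zero => simp
  | succ k ih =>
    have hu' : ContDiff ℝ ∞ (deriv u) := (contDiff_infty_iff_deriv.1 hu).2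
    have hφk := contDiff_iteratedDeriv hφ k
    have hφk' : ContDiff ℝ ∞ (deriv (iteratedDeriv k φ)) := (contDiff_infty_iff_deriv.1 hφk).2
    have hφkc := hasCompactSupport_iteratedDeriv hφc k
    have hparts := integral_mul_deriv_eq_deriv_mul_of_integrable
      (fun t _ => (hu.differentiable (by simp) t).hasDerivAt)
      (fun t _ => (hφk.differentiable (by simp) t).hasDerivAt)
      ((hu.continuous.mul hφk'.continuous).integrable_of_hasCompactSupport hφkc.deriv.mul_left)
      ((hu'.continuous.mul hφk.continuous).integrable_of_hasCompactSupport hφkc.mul_left)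
      ((hu.continuous.mul hφk.continuous).integrable_of_hasCompactSupport hφkc.mul_left)
    rw [iteratedDeriv_succ, hparts, ih hu', iteratedDeriv_succ']
    ring

theorem setIntegral_mul_iteratedDeriv {φ : ℝ → ℝ} {U : Set ℝ} (hφU : tsupport φ ⊆ U) (f : ℝ → ℝ)
    (k : ℕ) : ∫ x in U, f x * iteratedDeriv k φ x = ∫ x, f x * iteratedDeriv k φ x :=
  setIntegral_eq_integral_of_forall_compl_eq_zero fun x hx => by
    rw [image_eq_zero_of_notMem_tsupport fun h => hx (hφU (tsupport_iteratedDeriv_subset k φ h)),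
      mul_zero]

theorem integrable_mul_iteratedDeriv {f φ : ℝ → ℝ} {U : Set ℝ} (hf : LocallyIntegrableOn f U)
    (hφ : ContDiff ℝ ∞ φ) (hφc : HasCompactSupport φ) (hφU : tsupport φ ⊆ U) (k : ℕ) :
    Integrable fun x => f x * iteratedDeriv k φ x :=
  (integrableOn_iff_integrable_of_support_subset <|
    (Function.support_mul_subset_right _ _).trans <|
      (subset_tsupport _).trans (tsupport_iteratedDeriv_subset k φ)).1 <|
    (hf.integrableOn_compact_subset hφU hφc).mul_continuousOn
      (contDiff_iteratedDeriv hφ k).continuous.continuousOn hφc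

namespace HasNonnegDistribDeriv

variable {k : ℕ} {f g : ℝ → ℝ} {U : Set ℝ}

theorem of_iteratedDeriv_nonneg (hf : ContDiff ℝ ∞ f) (hfU : ∀ x ∈ U, 0 ≤ iteratedDeriv k f x) :
    HasNonnegDistribDeriv k f U := by
  refine ⟨hf.continuous.locallyIntegrable.locallyIntegrableOn U, fun φ hφ hφc hφU hφ₀ => ?_⟩
  rw [setIntegral_mul_iteratedDeriv hφU, integral_mul_iteratedDeriv hf hφ hφc, ← mul_assoc,
    ← mul_pow, neg_one_mul, neg_neg, one_pow, one_mul]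
  refine integral_nonneg fun x => ?_
  by_cases hx : x ∈ tsupport φ
  · exact mul_nonneg (hfU x (hφU hx)) (hφ₀ x)
  · simp [image_eq_zero_of_notMem_tsupport hx]

theorem const (hk : k ≠ 0) (s : ℝ) (U : Set ℝ) : HasNonnegDistribDeriv k (fun _ => s) U :=
  of_iteratedDeriv_nonneg contDiff_const fun x _ => by simp [iteratedDeriv_const, hk]

theorem add (hf : HasNonnegDistribDeriv k f U) (hg : HasNonnegDistribDeriv k g U) :
    HasNonnegDistribDeriv k (fun x => f x + g x) U := by
  refine ⟨hf.locallyIntegrableOn.add hg.locallyIntegrableOn, fun φ hφ hφc hφU hφ₀ => ?_⟩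
  have hfφ := integrable_mul_iteratedDeriv hf.locallyIntegrableOn hφ hφc hφU k
  have hgφ := integrable_mul_iteratedDeriv hg.locallyIntegrableOn hφ hφc hφU k
  simp only [add_mul]
  rw [integral_add hfφ.integrableOn hgφ.integrableOn, mul_add]
  exact add_nonneg (hf.nonneg φ hφ hφc hφU hφ₀) (hg.nonneg φ hφ hφc hφU hφ₀)

theorem congr_ae (hf : HasNonnegDistribDeriv k f U) (hfg : f =ᵐ[volume] g) :
    HasNonnegDistribDeriv k g U := by
  refine ⟨hf.locallyIntegrableOn.congr (ae_restrict_of_ae hfg), fun φ hφ hφc hφU hφ₀ => ?_⟩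
  have hcongr : (fun x => f x * iteratedDeriv k φ x) =ᵐ[volume.restrict U]
      fun x => g x * iteratedDeriv k φ x :=
    ae_restrict_of_ae (hfg.mul (ae_eq_refl (iteratedDeriv k φ)))
  rw [← integral_congr_ae hcongr]
  exact hf.nonneg φ hφ hφc hφU hφ₀

theorem of_tendsto {F : ℕ → ℝ → ℝ} (hF : ∀ m, HasNonnegDistribDeriv k (F m) U) {C : ℝ}
    (hC : ∀ m, ∀ᵐ x ∂volume.restrict U, |F m x| ≤ C)
    (hf : ∀ᵐ x ∂volume.restrict U, Tendsto (fun m => F m x) atTop (𝓝 (f x))) :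
    HasNonnegDistribDeriv k f U := by
  have hFm (m : ℕ) : AEStronglyMeasurable (F m) (volume.restrict U) :=
    (hF m).locallyIntegrableOn.aestronglyMeasurable
  have hfC : ∀ᵐ x ∂volume.restrict U, ‖f x‖ ≤ ‖C‖ := by
    filter_upwards [ae_all_iff.2 hC, hf] with x hx hfx
    exact le_of_tendsto hfx.norm (.of_forall fun m => (hx m).trans (le_abs_self C))
  refine ⟨locallyIntegrableOn_of_locallyIntegrable_restrict <| (locallyIntegrable_const C).mono
    (aestronglyMeasurable_of_tendsto_ae atTop hFm hf) hfC, fun φ hφ hφc hφU hφ₀ => ?_⟩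
  have hφk := (contDiff_iteratedDeriv hφ k).continuous
  have hφki : Integrable (iteratedDeriv k φ) :=
    hφk.integrable_of_hasCompactSupport (hasCompactSupport_iteratedDeriv hφc k)
  refine ge_of_tendsto' (Tendsto.const_mul _ <| tendsto_integral_of_dominated_convergence
    (fun x => C * |iteratedDeriv k φ x|) (fun m => (hFm m).mul hφk.aestronglyMeasurable)
    (hφki.abs.const_mul C).integrableOn (fun m => ?_) ?_) fun m => (hF m).nonneg φ hφ hφc hφU hφ₀
  · filter_upwards [hC m] with x hx
    rw [Pi.mul_apply, norm_mul]
    exact mul_le_mul_of_nonneg_right hx (norm_nonneg _)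
  · filter_upwards [hf] with x hx
    exact hx.mul_const _

theorem of_forall_isCompact (hU : IsOpen U)
    (h : ∀ K ⊆ U, IsCompact K → ∃ V, K ⊆ V ∧ HasNonnegDistribDeriv k f V) :
    HasNonnegDistribDeriv k f U := by
  refine ⟨(locallyIntegrableOn_iff hU.isLocallyClosed).2 fun K hKU hK => ?_,
    fun φ hφ hφc hφU hφ₀ => ?_⟩
  · obtain ⟨V, hKV, hV⟩ := h K hKU hK
    exact hV.locallyIntegrableOn.integrableOn_compact_subset hKV hK
  · obtain ⟨V, hφV, hV⟩ := h (tsupport φ) hφU hφc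
    rw [setIntegral_mul_iteratedDeriv hφU, ← setIntegral_mul_iteratedDeriv hφV]
    exact hV.nonneg φ hφ hφc hφV hφ₀

section Pencil

variable {n : ℕ} {A B : Matrix (Fin n) (Fin n) ℂ}

theorem traceFun_pencil_congr_ae (hk : k ≠ 0) (hA : A.IsHermitian) (hB : B.IsHermitian)
    (hf : HasNonnegDistribDeriv k (fun t => traceFun f (A + t • B)) U) (hfg : f =ᵐ[volume] g) :
    HasNonnegDistribDeriv k (fun t => traceFun g (A + t • B)) U := by
  obtain ⟨s, hs⟩ := exists_ae_traceFun_eq_add_const hA hB hfg.symm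
  exact (hf.add (const hk s U)).congr_ae (hs.mono fun t ht => ht.symm)

theorem traceFun_pencil_eval (hA : A.IsHermitian) (hB : B.IsHermitian) {S : Set ℝ} {c d : ℝ}
    (hS : S ⊆ Set.Icc c d) {p : ℝ[X]} (hp : ∀ x ∈ Set.Icc c d, 0 ≤ (derivative^[4] p).eval x) :
    HasNonnegDistribDeriv 4 (fun t => traceFun (fun x => p.eval x) (A + t • B))
      (pencilDomain S A B) :=
  of_iteratedDeriv_nonneg (contDiff_traceFun_eval hA hB p) fun _ ht =>
    iteratedDeriv_four_traceFun_eval_nonneg hA hB hp (ht.trans hS)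

-- Killing `f` and its approximants on the null set where they fail to converge changes the traces
-- by constants only, and makes them converge at every `t`.
theorem traceFun_pencil_Ioo {I : Set ℝ} (hI : IsOpen I) (hf : HasNonnegDistribDeriv 4 f I)
    (hA : A.IsHermitian) (hB : B.IsHermitian) {c d : ℝ} (hcd : Set.Icc c d ⊆ I) :
    HasNonnegDistribDeriv 4 (fun t => traceFun f (A + t • B))
      (pencilDomain (Set.Ioo c d) A B) := by
  obtain ⟨p, M, hp, hpM, hpf⟩ := hf.exists_polynomial_tendsto four_ne_zero hI hcd
  set W := {x | x ∈ Set.Icc c d → Tendsto (fun m => (p m).eval x) atTop (𝓝 (f x))}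
  have hW (g : ℝ → ℝ) : W.indicator g =ᵐ[volume] g :=
    hpf.mono fun x hx => Set.indicator_of_mem (s := W) hx g
  have hJ : MeasurableSet (pencilDomain (Set.Ioo c d) A B) :=
    (isOpen_pencilDomain hA hB isOpen_Ioo).measurableSet
  refine traceFun_pencil_congr_ae four_ne_zero hA hB (of_tendsto (C := n * M)
    (F := fun m t => traceFun (W.indicator fun x => (p m).eval x) (A + t • B))
    (fun m => traceFun_pencil_congr_ae four_ne_zero hA hB
      (traceFun_pencil_eval hA hB Set.Ioo_subset_Icc_self (hp m)) (hW _).symm)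
    (fun m => ae_restrict_of_forall_mem hJ fun t ht => ?_)
    (ae_restrict_of_forall_mem hJ fun t ht => ?_)) (hW f)
  · refine abs_traceFun_le (isHermitian_add_real_smul hA hB t) fun x hx => ?_
    exact (norm_indicator_le_norm_self (fun x => (p m).eval x) x).trans
      (hpM m x (Set.Ioo_subset_Icc_self (ht hx)))
  · refine tendsto_traceFun (isHermitian_add_real_smul hA hB t) fun x hx => ?_
    by_cases hxW : x ∈ W
    · simpa [hxW] using hxW (Set.Ioo_subset_Icc_self (ht hx))
    · simp [hxW]

end Pencil

end HasNonnegDistribDeriv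

theorem theorem3 (a b : EReal) (f : ℝ → ℝ)
    (hf : HasNonnegDistribDeriv 4 f (realInterval a b))
    (n : ℕ) (A B : Matrix (Fin n) (Fin n) ℂ) (hA : A.IsHermitian) (hB : B.IsHermitian) :
    HasNonnegDistribDeriv 4 (fun t : ℝ => traceFun f (A + t • B))
      (pencilDomain (realInterval a b) A B) := by
  have hI := isOpen_realInterval a b
  refine .of_forall_isCompact (isOpen_pencilDomain hA hB hI) fun K hKJ hK => ?_
  obtain ⟨S, hSI, hS, hKS⟩ := exists_isCompact_subset_pencilDomain hA hB hK hKJ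
  obtain ⟨c, d, hScd, hcdI⟩ :=
    exists_subset_Ioo_of_isCompact_subset hI (ordConnected_realInterval a b) hS hSI
  exact ⟨pencilDomain (Set.Ioo c d) A B, fun t ht => (hKS ht).trans hScd,
    hf.traceFun_pencil_Ioo hI hA hB hcdI⟩
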